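/- Let $d\ge 0$, $n=d+1$, let $(M,g)$ be an $n$-dimensional $C^\infty$ Lorentzian manifold of signature $(-,+,\dots,+)$, let $A\in\Lambda^1(M)$ be a smooth one-form, $q\in\mathbb{R}$ and $m>0$. On the tangent bundle $\pi:TM\to M$ consider - the Hamiltonian $H(x,p)=\tfrac12 g_x(p,p)$, - the one-form $\Theta_{(x,p)}(X)=g_x(p,\pi_*X)+q\,A_x(\pi_*X)$ and the symplectic form $\Omega_s=d\Theta$, - the volume form $\Lambda=\frac{(-1)^{n(n-1)/2}}{n!}\,\Omega_s\wedge\dots\wedge\Omega_s$ ($n$ factors), - the Liouville vector field $L$, defined by $dH=\Omega_s(\cdot,L)$. Let $\Gamma_m=H^{-1}(-m^2/2)=\{(x,p)\in TM: g_x(p,p)=-m^2\}$ be the mass shell, a $(2d+1)$-dimensional submanifold of $TM$ with inclusion $\iota$, to which $L$ is tangent; regard $L$ also as a vector field on $\Gamma_m$. Then there is exactly one $(2d+1)$-form $\Omega$ on $\Gamma_m$ of the form $\Omega=\iota^*\sigma$, where $\sigma$ is a smooth $(2d+1)$-form on $\{H<0\}\subset TM$ with $dH\wedge\sigma=\Lambda$.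 For this $\Omega$, the $2d$-form $\omega:=i_L\Omega$ on $\Gamma_m$ is smooth and closed, $d\omega=0$, and for every $C^\infty$ function $f:\Gamma_m\to\mathbb{R}$, $$d(f\omega)=(\pounds_L f)\,\Omega .$$ -/

import Mathlib

open scoped Manifold ContDiff Bundle
open Bundle

namespace RelKinetic

section LinearForms

variable {V : Type*} [AddCommGroup V] [Module ℝ V] [TopologicalSpace V]

/-- The wedge product `α ∧ β` of a covector with a `k`-covector, that is,
`(α ∧ β)(v₀, …, v_k) = ∑ i, (-1) ^ i α(v_i) β(v₀, …, v̂_i, …, v_k)` (see `wedgeOne_apply`). -/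
noncomputable def wedgeOne {k : ℕ} (α : V →L[ℝ] ℝ) (β : V [⋀^Fin k]→L[ℝ] ℝ) :
    V [⋀^Fin (k + 1)]→L[ℝ] ℝ where
  toMultilinearMap := (AlternatingMap.alternatizeUncurryFin
    ((α : V →ₗ[ℝ] ℝ).smulRight β.toAlternatingMap)).toMultilinearMap
  map_eq_zero_of_eq' := (AlternatingMap.alternatizeUncurryFin
    ((α : V →ₗ[ℝ] ℝ).smulRight β.toAlternatingMap)).map_eq_zero_of_eq'
  cont := by
    have : (fun v : Fin (k + 1) → V =>
        ∑ i : Fin (k + 1), (-1 : ℝ) ^ (i : ℕ) * (α (v i) * β (i.removeNth v))) =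
        fun v => AlternatingMap.alternatizeUncurryFin
          ((α : V →ₗ[ℝ] ℝ).smulRight β.toAlternatingMap) v := by
      funext v
      simp [AlternatingMap.alternatizeUncurryFin_apply, zsmul_eq_mul]
    change Continuous (fun v => AlternatingMap.alternatizeUncurryFin
          ((α : V →ₗ[ℝ] ℝ).smulRight β.toAlternatingMap) v)
    rw [← this]
    refine continuous_finsetSum _ fun i _ => Continuous.mul continuous_const
      (Continuous.mul ?_ ?_)
    · exact α.continuous.comp (continuous_apply i)
    · exact β.cont.comp (continuous_pi fun j => continuous_apply _)

theorem wedgeOne_apply {k : ℕ} (α : V →L[ℝ] ℝ) (β : V [⋀^Fin k]→L[ℝ] ℝ) (v : Fin (k + 1) → V) :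
    wedgeOne α β v = ∑ i : Fin (k + 1), (-1 : ℝ) ^ (i : ℕ) * (α (v i) * β (i.removeNth v)) := by
  change AlternatingMap.alternatizeUncurryFin
    ((α : V →ₗ[ℝ] ℝ).smulRight β.toAlternatingMap) v = _
  simp [AlternatingMap.alternatizeUncurryFin_apply, zsmul_eq_mul]

theorem pairProduct_aux {n N : ℕ} (h : 2 * n = N) (β : V [⋀^Fin 2]→L[ℝ] ℝ)
    (v : Fin N → V) (j : Fin N) (z : V) :
    (∏ i : Fin n, β ![Function.update v j z ⟨2 * i, by omega⟩,
        Function.update v j z ⟨2 * i + 1, by omega⟩]) =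
      β (Function.update ![v ⟨2 * (j / 2), by omega⟩, v ⟨2 * (j / 2) + 1, by omega⟩]
        ⟨j % 2, by omega⟩ z) *
      ∏ i ∈ Finset.univ.erase (⟨j / 2, by omega⟩ : Fin n),
        β ![v ⟨2 * i, by omega⟩, v ⟨2 * i + 1, by omega⟩] := by
  have hj : (j : ℕ) / 2 < n := by omega
  rw [← Finset.mul_prod_erase Finset.univ _ (Finset.mem_univ (⟨j / 2, hj⟩ : Fin n))]
  congr 1
  · congr 1
    funext l
    fin_cases l <;> rcases Nat.mod_two_eq_zero_or_one j with h2 | h2 <;>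
      simp [Function.update_apply, Fin.ext_iff, h2] <;> intro <;> omega
  · refine Finset.prod_congr rfl fun i hi => ?_
    have hi' : (i : ℕ) ≠ j / 2 := fun hh => (Finset.mem_erase.1 hi).1 (Fin.ext hh)
    rw [Function.update_of_ne (by simp only [ne_eq, Fin.ext_iff]; omega),
      Function.update_of_ne (by simp only [ne_eq, Fin.ext_iff]; omega)]

/-- The multilinear map `(v₀, …, v_{2n-1}) ↦ β(v₀, v₁) β(v₂, v₃) ⋯ β(v_{2n-2}, v_{2n-1})`. -/
noncomputable def pairProduct {n N : ℕ} (h : 2 * n = N) (β : V [⋀^Fin 2]→L[ℝ] ℝ) :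
    ContinuousMultilinearMap ℝ (fun _ : Fin N => V) ℝ where
  toFun v := ∏ i : Fin n, β ![v ⟨2 * i, by omega⟩, v ⟨2 * i + 1, by omega⟩]
  map_update_add' := by
    intro hdec v j x y
    obtain rfl : hdec = fun a b => instDecidableEqFin N a b := Subsingleton.elim _ _
    simp only [pairProduct_aux h, β.map_update_add, add_mul]
  map_update_smul' := by
    intro hdec v j c x
    obtain rfl : hdec = fun a b => instDecidableEqFin N a b := Subsingleton.elim _ _
    simp only [pairProduct_aux h, β.map_update_smul, smul_mul_assoc]
  cont := by
    refine continuous_finsetProd _ fun i _ => β.cont.comp ?_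
    refine continuous_pi fun j => ?_
    fin_cases j <;> simp <;> fun_prop

/-- The `n`-fold wedge product `β ∧ ⋯ ∧ β` of a `2`-covector, that is,
`(β ∧ ⋯ ∧ β)(v₀, …, v_{2n-1}) = 2⁻ⁿ ∑ π, sgn π ∏ i, β(v_{π(2i)}, v_{π(2i+1)})`,
where `π` ranges over the permutations of `{0, …, 2n-1}`. The degree is written `N = 2n`. -/
noncomputable def wedgePow {n N : ℕ} (h : 2 * n = N) (β : V [⋀^Fin 2]→L[ℝ] ℝ) :
    V [⋀^Fin N]→L[ℝ] ℝ :=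
  ((2 : ℝ) ^ n)⁻¹ • ContinuousMultilinearMap.alternatization (pairProduct h β)

/-- The interior product `i_v β = β(v, ·, …, ·)`. -/
def interiorProduct {k : ℕ} (v : V) (β : V [⋀^Fin (k + 1)]→L[ℝ] ℝ) : V [⋀^Fin k]→L[ℝ] ℝ where
  toMultilinearMap := (β.toAlternatingMap.curryLeft v).toMultilinearMap
  map_eq_zero_of_eq' := (β.toAlternatingMap.curryLeft v).map_eq_zero_of_eq'
  cont := β.cont.comp (continuous_pi fun j => by
    refine Fin.cases ?_ (fun j => ?_) j
    · exact continuous_const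
    · exact continuous_apply j)

theorem interiorProduct_apply {k : ℕ} (v : V) (β : V [⋀^Fin (k + 1)]→L[ℝ] ℝ) (w : Fin k → V) :
    interiorProduct v β w = β (Fin.cons v w) := rfl

end LinearForms

section ManifoldForms

variable {E : Type*} [NormedAddCommGroup E] [NormedSpace ℝ E]
  {H : Type*} [TopologicalSpace H]

/-- A (not necessarily smooth) field of `k`-covectors on the manifold `N`. -/
abbrev DiffForm (I : ModelWithCorners ℝ E H) (N : Type*) [TopologicalSpace N] [ChartedSpace H N]
    (k : ℕ) :=
  Π x : N, TangentSpace I x [⋀^Fin k]→L[ℝ] ℝ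

variable {I : ModelWithCorners ℝ E H} {N : Type*} [TopologicalSpace N] [ChartedSpace H N]

/-- The expression of a `k`-form in the preferred chart `φ` at `x`: the pull-back
`(φ⁻¹)^* α`, a `k`-form on the open set `φ.target` of the model vector space. -/
noncomputable def formInChart {k : ℕ} (α : DiffForm I N k) (x : N) (y : E) :
    E [⋀^Fin k]→L[ℝ] ℝ :=
  (α ((extChartAt I x).symm y)).compContinuousLinearMap
    (mfderiv 𝓘(ℝ, E) I (extChartAt I x).symm y)

/-- The exterior derivative of a `k`-form on a manifold without boundary, computed at `x` in the
preferred chart `φ` at `x`: `(dα)_x = φ^* (d ((φ⁻¹)^* α))`. -/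
noncomputable def mExtDeriv [I.Boundaryless] {k : ℕ} (α : DiffForm I N k) :
    DiffForm I N (k + 1) := fun x =>
  (extDeriv (formInChart α x) (extChartAt I x x)).compContinuousLinearMap
    (mfderiv I 𝓘(ℝ, E) (extChartAt I x) x)

/-- A `k`-form on a manifold without boundary is `C^∞` on the open set `U` if its expressions in
charts are `C^∞` on the part of the chart domain lying in `U`. -/
def SmoothFormOn [I.Boundaryless] {k : ℕ} (α : DiffForm I N k) (U : Set N) : Prop :=
  ∀ x : N, ContDiffOn ℝ ∞ (formInChart α x)
    ((extChartAt I x).target ∩ (extChartAt I x).symm ⁻¹' U)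

/-- The pull-back `F^* α` of a `k`-form under a map of manifolds. -/
noncomputable def pullbackForm {E' : Type*} [NormedAddCommGroup E'] [NormedSpace ℝ E']
    {H' : Type*} [TopologicalSpace H'] {I' : ModelWithCorners ℝ E' H'}
    {N' : Type*} [TopologicalSpace N'] [ChartedSpace H' N'] {k : ℕ}
    (F : N' → N) (α : DiffForm I N k) : DiffForm I' N' k := fun x =>
  (α (F x)).compContinuousLinearMap (mfderiv I' I F x)

end ManifoldForms

section Spacetime

variable {d : ℕ} {M : Type*} [TopologicalSpace M]
  [ChartedSpace (EuclideanSpace ℝ (Fin (d + 1))) M] [IsManifold (𝓡 (d + 1)) ∞ M]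

/-- A smooth Lorentzian metric of signature `(-, +, …, +)` on the `(d + 1)`-dimensional manifold
`M`: a smooth section of the bundle of bilinear forms on the tangent spaces that is symmetric and
admits at each point a basis `b₀, …, b_d` with `g(b₀, b₀) = -1`, `g(b_i, b_i) = 1` for `i ≥ 1` and
`g(b_i, b_j) = 0` for `i ≠ j`. -/
structure LorentzianMetric (d : ℕ) (M : Type*) [TopologicalSpace M]
    [ChartedSpace (EuclideanSpace ℝ (Fin (d + 1))) M] [IsManifold (𝓡 (d + 1)) ∞ M] where
  val : Π x : M, TangentSpace (𝓡 (d + 1)) x →L[ℝ] TangentSpace (𝓡 (d + 1)) x →L[ℝ] ℝ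
  symm : ∀ (x : M) (v w : TangentSpace (𝓡 (d + 1)) x), val x v w = val x w v
  signature : ∀ x : M, ∃ b : Module.Basis (Fin (d + 1)) ℝ (TangentSpace (𝓡 (d + 1)) x),
    ∀ i j, val x (b i) (b j) = if i = j then (if i = 0 then -1 else 1) else 0
  contMDiff : ContMDiff (𝓡 (d + 1))
    ((𝓡 (d + 1)).prod 𝓘(ℝ, EuclideanSpace ℝ (Fin (d + 1)) →L[ℝ]
      EuclideanSpace ℝ (Fin (d + 1)) →L[ℝ] ℝ)) ∞
    (fun x => TotalSpace.mk' (EuclideanSpace ℝ (Fin (d + 1)) →L[ℝ]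
      EuclideanSpace ℝ (Fin (d + 1)) →L[ℝ] ℝ) x (val x))

/-- A smooth one-form on `M`, in the role of the electromagnetic potential. -/
structure Potential (d : ℕ) (M : Type*) [TopologicalSpace M]
    [ChartedSpace (EuclideanSpace ℝ (Fin (d + 1))) M] [IsManifold (𝓡 (d + 1)) ∞ M] where
  val : Π x : M, TangentSpace (𝓡 (d + 1)) x →L[ℝ] ℝ
  contMDiff : ContMDiff (𝓡 (d + 1))
    ((𝓡 (d + 1)).prod 𝓘(ℝ, EuclideanSpace ℝ (Fin (d + 1)) →L[ℝ] ℝ)) ∞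
    (fun x => TotalSpace.mk' (EuclideanSpace ℝ (Fin (d + 1)) →L[ℝ] ℝ)
      (E := fun x : M => TangentSpace (𝓡 (d + 1)) x →L[ℝ] ℝ) x (val x))

/-- The Hamiltonian `H(x, p) = g_x(p, p) / 2` on the tangent bundle. -/
noncomputable def hamiltonian (g : LorentzianMetric d M) (z : TangentBundle (𝓡 (d + 1)) M) : ℝ :=
  g.val z.proj z.snd z.snd / 2

/-- The Poincaré one-form `Θ_{(x, p)}(X) = g_x(p, π_* X) + q A_x(π_* X)` on the tangent bundle. -/
noncomputable def poincareForm (g : LorentzianMetric d M) (A : Potential d M) (q : ℝ) :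
    DiffForm (𝓡 (d + 1)).tangent (TangentBundle (𝓡 (d + 1)) M) 1 := fun z =>
  ContinuousAlternatingMap.ofSubsingleton ℝ _ _ (0 : Fin 1)
    ((g.val z.proj z.snd + q • A.val z.proj).comp
      (mfderiv (𝓡 (d + 1)).tangent (𝓡 (d + 1))
        (TotalSpace.proj : TangentBundle (𝓡 (d + 1)) M → M) z))

/-- The symplectic form `Ω_s = dΘ` on the tangent bundle. -/
noncomputable def symplecticForm (g : LorentzianMetric d M) (A : Potential d M) (q : ℝ) :
    DiffForm (𝓡 (d + 1)).tangent (TangentBundle (𝓡 (d + 1)) M) 2 :=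
  mExtDeriv (poincareForm g A q)

/-- The volume form `Λ = ((-1)^(n(n-1)/2) / n!) Ω_s ∧ ⋯ ∧ Ω_s` (`n = d + 1` factors) on the tangent
bundle; its degree is `2n = 2d + 2`. -/
noncomputable def tangentVolumeForm (g : LorentzianMetric d M) (A : Potential d M) (q : ℝ) :
    DiffForm (𝓡 (d + 1)).tangent (TangentBundle (𝓡 (d + 1)) M) (2 * d + 1 + 1) := fun z =>
  ((-1 : ℝ) ^ ((d + 1) * d / 2) / (Nat.factorial (d + 1) : ℝ)) •
    wedgePow (n := d + 1) (by ring) (symplecticForm g A q z)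

/-- The differential `dH` of the Hamiltonian. -/
noncomputable def dHamiltonian (g : LorentzianMetric d M) (z : TangentBundle (𝓡 (d + 1)) M) :
    TangentSpace (𝓡 (d + 1)).tangent z →L[ℝ] ℝ :=
  mvfderiv (𝓡 (d + 1)).tangent (hamiltonian g) z

/-- The Liouville vector field `L` on the tangent bundle: the Hamiltonian vector field of `H`,
that is, the vector field (unique, since `Ω_s` is non-degenerate) with `dH = Ω_s(·, L)`. -/
noncomputable def liouvilleField (g : LorentzianMetric d M) (A : Potential d M) (q : ℝ)
    (z : TangentBundle (𝓡 (d + 1)) M) : TangentSpace (𝓡 (d + 1)).tangent z :=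
  Classical.epsilon fun v => ∀ u, dHamiltonian g z u = symplecticForm g A q z ![u, v]

/-- The mass shell `Γ_m = H⁻¹(-m²/2) = {(x, p) : g_x(p, p) = -m²}`. -/
@[ext]
structure MassShell (g : LorentzianMetric d M) (m : ℝ) where
  /-- The inclusion `ι : Γ_m → TM`. -/
  incl : TangentBundle (𝓡 (d + 1)) M
  hamiltonian_eq : hamiltonian g incl = -m ^ 2 / 2

/-- The mass shell carries the topology induced by the tangent bundle. -/
noncomputable instance (g : LorentzianMetric d M) (m : ℝ) : TopologicalSpace (MassShell g m) :=
  TopologicalSpace.induced MassShell.incl inferInstance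

theorem MassShell.isInducing_incl (g : LorentzianMetric d M) (m : ℝ) :
    Topology.IsInducing (MassShell.incl (g := g) (m := m)) := ⟨rfl⟩

theorem contMDiff_hamiltonian (g : LorentzianMetric d M) :
    ContMDiff (𝓡 (d + 1)).tangent 𝓘(ℝ, ℝ) ∞ (hamiltonian g) := by
  have h1 : ContMDiff (𝓡 (d + 1)).tangent ((𝓡 (d + 1)).prod 𝓘(ℝ, ℝ)) ∞
      (fun z : TangentBundle (𝓡 (d + 1)) M =>
        TotalSpace.mk' ℝ (E := Bundle.Trivial M ℝ) z.proj (g.val z.proj z.snd z.snd)) := by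
    intro z
    apply ContMDiffAt.clm_bundle_apply₂ (F₁ := EuclideanSpace ℝ (Fin (d + 1)))
      (F₂ := EuclideanSpace ℝ (Fin (d + 1)))
    · exact (g.contMDiff.comp (contMDiff_proj _)).contMDiffAt
    · exact contMDiff_id.contMDiffAt
    · exact contMDiff_id.contMDiffAt
  have h2 : ContMDiff (𝓡 (d + 1)).tangent 𝓘(ℝ, ℝ) ∞
      (fun z : TangentBundle (𝓡 (d + 1)) M => g.val z.proj z.snd z.snd) := by
    intro z
    have := h1 z
    simp only [contMDiffAt_totalSpace] at this
    exact this.2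
  have h3 : hamiltonian g = fun z : TangentBundle (𝓡 (d + 1)) M =>
      (1 / 2 : ℝ) • g.val z.proj z.snd z.snd := by
    funext z; simp [hamiltonian]; ring
  rw [h3]
  exact (contDiff_const_smul (1 / 2 : ℝ)).contMDiff.comp h2

section Charts

theorem tangent_chart_symm_smul (z₀ : TangentBundle (𝓡 (d + 1)) M)
    (y v : EuclideanSpace ℝ (Fin (d + 1))) (c : ℝ) (g : LorentzianMetric d M) :
    hamiltonian g ((extChartAt (𝓡 (d + 1)).tangent z₀).symm (y, c • v)) =
      c ^ 2 * hamiltonian g ((extChartAt (𝓡 (d + 1)).tangent z₀).symm (y, v)) := by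
  have key : ∀ w, (extChartAt (𝓡 (d + 1)).tangent z₀).symm (y, w) =
      ⟨(chartAt (EuclideanSpace ℝ (Fin (d + 1))) z₀.proj).symm y,
        (tangentBundleCore (𝓡 (d + 1)) M).coordChange
          (achart (EuclideanSpace ℝ (Fin (d + 1))) z₀.proj)
          (achart (EuclideanSpace ℝ (Fin (d + 1)))
            ((chartAt (EuclideanSpace ℝ (Fin (d + 1))) z₀.proj).symm y))
          ((chartAt (EuclideanSpace ℝ (Fin (d + 1))) z₀.proj).symm y) w⟩ := fun w => rfl
  have hB : ∀ (x : M) (B : TangentSpace (𝓡 (d + 1)) x →L[ℝ] TangentSpace (𝓡 (d + 1)) x →L[ℝ] ℝ)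
      (w : TangentSpace (𝓡 (d + 1)) x), B (c • w) (c • w) / 2 = c ^ 2 * (B w w / 2) := by
    intro x B w
    rw [map_smul, map_smul, smul_apply, smul_eq_mul, smul_eq_mul]
    ring
  rw [key, key]
  simp only [hamiltonian]
  rw [map_smul]
  exact hB _ _ _

/-- The vector with `i`-th coordinate `1` and the other coordinates `u`. -/
noncomputable def homog (i : Fin (d + 1)) (u : EuclideanSpace ℝ (Fin d)) :
    EuclideanSpace ℝ (Fin (d + 1)) :=
  WithLp.toLp 2 (i.insertNth 1 fun j => u j)

/-- The ratios `v_j / v_i`, `j ≠ i`. -/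
noncomputable def slope (i : Fin (d + 1)) (v : EuclideanSpace ℝ (Fin (d + 1))) :
    EuclideanSpace ℝ (Fin d) :=
  WithLp.toLp 2 fun j => v (i.succAbove j) / v i

theorem homog_self (i : Fin (d + 1)) (u : EuclideanSpace ℝ (Fin d)) : homog i u i = 1 := by
  simp [homog]

theorem slope_smul_homog (i : Fin (d + 1)) (u : EuclideanSpace ℝ (Fin d)) {c : ℝ} (hc : c ≠ 0) :
    slope i (c • homog i u) = u := by
  ext j
  simp [slope, homog, hc]

theorem smul_homog_slope (i : Fin (d + 1)) (v : EuclideanSpace ℝ (Fin (d + 1))) (hv : v i ≠ 0) :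
    v i • homog i (slope i v) = v := by
  ext j
  refine Fin.succAboveCases i ?_ (fun j => ?_) j
  · simp [slope, homog]
  · simp [slope, homog]
    field_simp

theorem contDiff_homog (i : Fin (d + 1)) : ContDiff ℝ ∞ (homog i) := by
  rw [contDiff_euclidean]
  intro j
  refine Fin.succAboveCases i ?_ (fun j => ?_) j
  · simp [homog]; exact contDiff_const
  · simp [homog]; fun_prop

theorem contDiffOn_slope (i : Fin (d + 1)) : ContDiffOn ℝ ∞ (slope i) {v | v i ≠ 0} := by
  rw [contDiffOn_euclidean]
  intro j
  simp only [slope]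
  exact ContDiffOn.div (by fun_prop) (by fun_prop) fun v hv => hv

theorem mem_tangent_chart_target (z₀ : TangentBundle (𝓡 (d + 1)) M)
    {y v : EuclideanSpace ℝ (Fin (d + 1))} (w : EuclideanSpace ℝ (Fin (d + 1)))
    (h : (y, v) ∈ (extChartAt (𝓡 (d + 1)).tangent z₀).target) :
    (y, w) ∈ (extChartAt (𝓡 (d + 1)).tangent z₀).target := by
  have key : ∀ w, (y, w) ∈ (extChartAt (𝓡 (d + 1)).tangent z₀).target ↔
      y ∈ (chartAt (EuclideanSpace ℝ (Fin (d + 1))) z₀.proj).target := fun w => by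
    simp [extChartAt]
    exact TangentBundle.mem_chart_target_iff (I := 𝓡 (d + 1)) (y, w) z₀
  rw [key] at h ⊢
  exact h

/-- The point of the tangent bundle with coordinates `(y, λ w)` in the adapted chart at `z₀`, where
`w` has the coordinates `w_i = 1`, `w_j = u_j` and `λ` is determined by `λ² g_y(w, w) = -m²` and
`sign λ = s`. -/
noncomputable def shellPoint (g : LorentzianMetric d M) (m : ℝ)
    (z₀ : TangentBundle (𝓡 (d + 1)) M) (i : Fin (d + 1)) (s : ℝ)
    (a : EuclideanSpace ℝ (Fin (d + 1)) × EuclideanSpace ℝ (Fin d)) :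
    EuclideanSpace ℝ (Fin (d + 1)) × EuclideanSpace ℝ (Fin (d + 1)) :=
  (a.1, (s * m / √(-2 * hamiltonian g
    ((extChartAt (𝓡 (d + 1)).tangent z₀).symm (a.1, homog i a.2)))) • homog i a.2)

/-- The coordinates `(y, u)` such that `g_y(w, w) < 0` for the vector `w` with coordinates `w_i = 1`,
`w_j = u_j`. -/
def shellTarget (g : LorentzianMetric d M) (z₀ : TangentBundle (𝓡 (d + 1)) M) (i : Fin (d + 1)) :
    Set (EuclideanSpace ℝ (Fin (d + 1)) × EuclideanSpace ℝ (Fin d)) :=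
  {a | (a.1, homog i a.2) ∈ (extChartAt (𝓡 (d + 1)).tangent z₀).target ∧
    hamiltonian g ((extChartAt (𝓡 (d + 1)).tangent z₀).symm (a.1, homog i a.2)) < 0}

theorem contDiffOn_hamiltonian_chart (g : LorentzianMetric d M)
    (z₀ : TangentBundle (𝓡 (d + 1)) M) :
    ContDiffOn ℝ ∞ (hamiltonian g ∘ (extChartAt (𝓡 (d + 1)).tangent z₀).symm)
      (extChartAt (𝓡 (d + 1)).tangent z₀).target := by
  rw [← contMDiffOn_iff_contDiffOn]
  exact (contMDiff_hamiltonian g).comp_contMDiffOn (contMDiffOn_extChartAt_symm z₀)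

theorem contDiff_homog_pair (i : Fin (d + 1)) :
    ContDiff ℝ ∞ (fun a : EuclideanSpace ℝ (Fin (d + 1)) × EuclideanSpace ℝ (Fin d) =>
      (a.1, homog i a.2)) :=
  contDiff_fst.prodMk ((contDiff_homog i).comp contDiff_snd)

theorem isOpen_shellTarget (g : LorentzianMetric d M) (z₀ : TangentBundle (𝓡 (d + 1)) M)
    (i : Fin (d + 1)) : IsOpen (shellTarget g z₀ i) := by
  have h1 : IsOpen ((extChartAt (𝓡 (d + 1)).tangent z₀).target ∩
      (hamiltonian g ∘ (extChartAt (𝓡 (d + 1)).tangent z₀).symm) ⁻¹' Set.Iio 0) :=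
    (contDiffOn_hamiltonian_chart g z₀).continuousOn.isOpen_inter_preimage
      (isOpen_extChartAt_target z₀) isOpen_Iio
  exact h1.preimage (contDiff_homog_pair i).continuous

theorem contDiffOn_shellPoint (g : LorentzianMetric d M) (m : ℝ)
    (z₀ : TangentBundle (𝓡 (d + 1)) M) (i : Fin (d + 1)) (s : ℝ) :
    ContDiffOn ℝ ∞ (shellPoint g m z₀ i s) (shellTarget g z₀ i) := by
  have h1 : ContDiffOn ℝ ∞ (fun a : EuclideanSpace ℝ (Fin (d + 1)) × EuclideanSpace ℝ (Fin d) =>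
      hamiltonian g ((extChartAt (𝓡 (d + 1)).tangent z₀).symm (a.1, homog i a.2)))
      (shellTarget g z₀ i) :=
    (contDiffOn_hamiltonian_chart g z₀).comp (contDiff_homog_pair i).contDiffOn fun a ha => ha.1
  have h2 : ∀ a ∈ shellTarget g z₀ i, -2 * hamiltonian g
      ((extChartAt (𝓡 (d + 1)).tangent z₀).symm (a.1, homog i a.2)) ≠ 0 := fun a ha => by
    have := ha.2
    intro h
    linarith
  have h3 : ContDiffOn ℝ ∞
      (fun a : EuclideanSpace ℝ (Fin (d + 1)) × EuclideanSpace ℝ (Fin d) =>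
        s * m / √(-2 * hamiltonian g
          ((extChartAt (𝓡 (d + 1)).tangent z₀).symm (a.1, homog i a.2))))
      (shellTarget g z₀ i) := by
    refine contDiffOn_const.div ((contDiffOn_const.mul h1).sqrt h2) fun a ha => ?_
    have := ha.2
    exact (Real.sqrt_pos.2 (by linarith)).ne'
  have h4 : ContDiffOn ℝ ∞
      (fun a : EuclideanSpace ℝ (Fin (d + 1)) × EuclideanSpace ℝ (Fin d) => homog i a.2)
      (shellTarget g z₀ i) := ((contDiff_homog i).comp contDiff_snd).contDiffOn
  exact contDiff_fst.contDiffOn.prodMk (h3.smul h4)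

theorem shellPoint_mem_target (g : LorentzianMetric d M) (m : ℝ)
    (z₀ : TangentBundle (𝓡 (d + 1)) M) (i : Fin (d + 1)) (s : ℝ)
    {a : EuclideanSpace ℝ (Fin (d + 1)) × EuclideanSpace ℝ (Fin d)} (ha : a ∈ shellTarget g z₀ i) :
    shellPoint g m z₀ i s a ∈ (extChartAt (𝓡 (d + 1)).tangent z₀).target :=
  mem_tangent_chart_target z₀ _ ha.1

theorem hamiltonian_shellPoint (g : LorentzianMetric d M) (m : ℝ)
    (z₀ : TangentBundle (𝓡 (d + 1)) M) (i : Fin (d + 1)) {s : ℝ} (hs : s = 1 ∨ s = -1)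
    {a : EuclideanSpace ℝ (Fin (d + 1)) × EuclideanSpace ℝ (Fin d)} (ha : a ∈ shellTarget g z₀ i) :
    hamiltonian g ((extChartAt (𝓡 (d + 1)).tangent z₀).symm (shellPoint g m z₀ i s a)) =
      -m ^ 2 / 2 := by
  have h := ha.2
  have hs2 : s ^ 2 = 1 := by rcases hs with rfl | rfl <;> norm_num
  rw [shellPoint, tangent_chart_symm_smul, div_pow, Real.sq_sqrt (by linarith), mul_pow, hs2]
  have h0 := h.ne
  field_simp

/-- The ambient coordinates of a point of the tangent bundle mapped to `(y, (p_j / p_i)_{j ≠ i})`. -/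
noncomputable def shellCoord (i : Fin (d + 1))
    (b : EuclideanSpace ℝ (Fin (d + 1)) × EuclideanSpace ℝ (Fin (d + 1))) :
    EuclideanSpace ℝ (Fin (d + 1)) × EuclideanSpace ℝ (Fin d) :=
  (b.1, slope i b.2)

theorem contDiffOn_shellCoord (i : Fin (d + 1)) :
    ContDiffOn ℝ ∞ (shellCoord i) {b | b.2 i ≠ 0} :=
  contDiff_fst.contDiffOn.prodMk
    ((contDiffOn_slope i).comp contDiff_snd.contDiffOn fun _ hb => hb)

theorem shellCoord_mem_target (g : LorentzianMetric d M) {m : ℝ} (hm : 0 < m)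
    (z₀ : TangentBundle (𝓡 (d + 1)) M) (i : Fin (d + 1))
    {b : EuclideanSpace ℝ (Fin (d + 1)) × EuclideanSpace ℝ (Fin (d + 1))}
    (hb : b ∈ (extChartAt (𝓡 (d + 1)).tangent z₀).target) (hi : b.2 i ≠ 0)
    (hH : hamiltonian g ((extChartAt (𝓡 (d + 1)).tangent z₀).symm b) = -m ^ 2 / 2) :
    shellCoord i b ∈ shellTarget g z₀ i := by
  refine ⟨mem_tangent_chart_target z₀ _ hb, ?_⟩
  have h1 : b = (b.1, b.2 i • homog i (slope i b.2)) := by rw [smul_homog_slope i b.2 hi]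
  rw [h1, tangent_chart_symm_smul] at hH
  have h2 : 0 < b.2 i ^ 2 := by positivity
  have h3 : 0 < m ^ 2 := by positivity
  simp only [shellCoord]
  by_contra h
  push Not at h
  nlinarith [mul_nonneg h2.le h]

theorem shellPoint_shellCoord (g : LorentzianMetric d M) {m : ℝ} (hm : 0 < m)
    (z₀ : TangentBundle (𝓡 (d + 1)) M) (i : Fin (d + 1)) {s : ℝ} (hs : s = 1 ∨ s = -1)
    {b : EuclideanSpace ℝ (Fin (d + 1)) × EuclideanSpace ℝ (Fin (d + 1))} (hi : 0 < s * b.2 i)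
    (hH : hamiltonian g ((extChartAt (𝓡 (d + 1)).tangent z₀).symm b) = -m ^ 2 / 2) :
    shellPoint g m z₀ i s (shellCoord i b) = b := by
  have hi0 : b.2 i ≠ 0 := by rintro h; simp [h] at hi
  have h1 : b = (b.1, b.2 i • homog i (slope i b.2)) := by rw [smul_homog_slope i b.2 hi0]
  have hH' := hH
  rw [h1, tangent_chart_symm_smul] at hH'
  have hs2 : s * s = 1 := by rcases hs with rfl | rfl <;> norm_num
  set h := hamiltonian g ((extChartAt (𝓡 (d + 1)).tangent z₀).symm (b.1, homog i (slope i b.2)))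
    with hh
  have h2 : -2 * h = (m / (s * b.2 i)) ^ 2 := by
    have : (s * b.2 i) ^ 2 = b.2 i ^ 2 := by rw [mul_pow, pow_two s, hs2, one_mul]
    rw [div_pow, this]
    field_simp
    linarith
  have h3 : s * m / √(-2 * h) = b.2 i := by
    rw [h2, Real.sqrt_sq (by positivity)]
    field_simp
    rw [pow_two, hs2]
  simp only [shellPoint, shellCoord]
  rw [← hh, h3, smul_homog_slope i b.2 hi0]

theorem shellCoord_shellPoint (g : LorentzianMetric d M) {m : ℝ} (hm : 0 < m)
    (z₀ : TangentBundle (𝓡 (d + 1)) M) (i : Fin (d + 1)) {s : ℝ} (hs : s = 1 ∨ s = -1)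
    {a : EuclideanSpace ℝ (Fin (d + 1)) × EuclideanSpace ℝ (Fin d)} (ha : a ∈ shellTarget g z₀ i) :
    shellCoord i (shellPoint g m z₀ i s a) = a ∧ 0 < s * (shellPoint g m z₀ i s a).2 i := by
  have h := ha.2
  have h1 := Real.sqrt_pos.2 (show 0 < -2 * hamiltonian g
    ((extChartAt (𝓡 (d + 1)).tangent z₀).symm (a.1, homog i a.2)) by linarith)
  have hs2 : s * s = 1 := by rcases hs with rfl | rfl <;> norm_num
  have hs0 : s ≠ 0 := by rintro rfl; simp at hs2
  constructor
  · simp only [shellCoord, shellPoint]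
    rw [slope_smul_homog i a.2 (by positivity)]
  · simp only [shellPoint, PiLp.smul_apply, homog_self, smul_eq_mul, mul_one]
    rw [mul_div_assoc', ← mul_assoc, hs2, one_mul]
    positivity

open Classical in
/-- The inverse of a chart of the mass shell (the value outside the target is irrelevant). -/
noncomputable def shellInv {g : LorentzianMetric d M} {m : ℝ} (z₀ : MassShell g m)
    (i : Fin (d + 1)) (s : ℝ) (hs : s = 1 ∨ s = -1)
    (a : EuclideanSpace ℝ (Fin (d + 1)) × EuclideanSpace ℝ (Fin d)) : MassShell g m :=
  if ha : a ∈ shellTarget g z₀.incl i then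
    ⟨(extChartAt (𝓡 (d + 1)).tangent z₀.incl).symm (shellPoint g m z₀.incl i s a),
      hamiltonian_shellPoint g m z₀.incl i hs ha⟩ else z₀

theorem incl_shellInv {g : LorentzianMetric d M} {m : ℝ} (z₀ : MassShell g m)
    (i : Fin (d + 1)) (s : ℝ) (hs : s = 1 ∨ s = -1)
    {a : EuclideanSpace ℝ (Fin (d + 1)) × EuclideanSpace ℝ (Fin d)}
    (ha : a ∈ shellTarget g z₀.incl i) :
    (shellInv z₀ i s hs a).incl =
      (extChartAt (𝓡 (d + 1)).tangent z₀.incl).symm (shellPoint g m z₀.incl i s a) := by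
  rw [shellInv, dif_pos ha]

theorem ne_zero_of_sign {s t : ℝ} (h : 0 < s * t) : t ≠ 0 := by
  rintro rfl
  simp at h

/-- The chart `(x, p) ↦ (x^μ, (p^j / p^i)_{j ≠ i})` of the mass shell, on the set of points of
the mass shell over the chart domain of `M` at the base point of `z₀` for which the adapted
coordinate `p^i` has the sign `s`. -/
noncomputable def shellChart {g : LorentzianMetric d M} {m : ℝ} (hm : 0 < m) (z₀ : MassShell g m)
    (i : Fin (d + 1)) (s : ℝ) (hs : s = 1 ∨ s = -1) :
    OpenPartialHomeomorph (MassShell g m)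
      (EuclideanSpace ℝ (Fin (d + 1)) × EuclideanSpace ℝ (Fin d)) where
  toFun z := shellCoord i (extChartAt (𝓡 (d + 1)).tangent z₀.incl z.incl)
  invFun a := shellInv z₀ i s hs a
  source := {z | z.incl ∈ (extChartAt (𝓡 (d + 1)).tangent z₀.incl).source ∧
    0 < s * (extChartAt (𝓡 (d + 1)).tangent z₀.incl z.incl).2 i}
  target := shellTarget g z₀.incl i
  map_source' z hz := by
    refine shellCoord_mem_target g hm z₀.incl i (PartialEquiv.map_source _ hz.1)
      (ne_zero_of_sign hz.2) ?_
    rw [PartialEquiv.left_inv _ hz.1]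
    exact z.hamiltonian_eq
  map_target' a ha := by
    rw [Set.mem_ofPred_eq, incl_shellInv z₀ i s hs ha]
    refine ⟨PartialEquiv.map_target _ (shellPoint_mem_target g m z₀.incl i s ha), ?_⟩
    rw [PartialEquiv.right_inv _ (shellPoint_mem_target g m z₀.incl i s ha)]
    exact (shellCoord_shellPoint g hm z₀.incl i hs ha).2
  left_inv' z hz := by
    have hH : hamiltonian g ((extChartAt (𝓡 (d + 1)).tangent z₀.incl).symm
        (extChartAt (𝓡 (d + 1)).tangent z₀.incl z.incl)) = -m ^ 2 / 2 := by
      rw [PartialEquiv.left_inv _ hz.1]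
      exact z.hamiltonian_eq
    apply MassShell.ext
    rw [incl_shellInv z₀ i s hs (shellCoord_mem_target g hm z₀.incl i
      (PartialEquiv.map_source _ hz.1) (ne_zero_of_sign hz.2) hH),
      shellPoint_shellCoord g hm z₀.incl i hs hz.2 hH, PartialEquiv.left_inv _ hz.1]
  right_inv' a ha := by
    rw [incl_shellInv z₀ i s hs ha,
      PartialEquiv.right_inv _ (shellPoint_mem_target g m z₀.incl i s ha)]
    exact (shellCoord_shellPoint g hm z₀.incl i hs ha).1
  open_source := by
    have h1 : IsOpen ((extChartAt (𝓡 (d + 1)).tangent z₀.incl).source ∩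
        (extChartAt (𝓡 (d + 1)).tangent z₀.incl) ⁻¹' {b | 0 < s * b.2 i}) :=
      (continuousOn_extChartAt z₀.incl).isOpen_inter_preimage (isOpen_extChartAt_source z₀.incl)
        (isOpen_lt continuous_const (by fun_prop))
    exact h1.preimage (MassShell.isInducing_incl g m).continuous
  open_target := isOpen_shellTarget g z₀.incl i
  continuousOn_toFun :=
    (contDiffOn_shellCoord i).continuousOn.comp
      ((continuousOn_extChartAt z₀.incl).comp (MassShell.isInducing_incl g m).continuous.continuousOn
        fun z hz => hz.1) fun z hz => ne_zero_of_sign hz.2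
  continuousOn_invFun := by
    have h1 : ContinuousOn (fun a => (extChartAt (𝓡 (d + 1)).tangent z₀.incl).symm
        (shellPoint g m z₀.incl i s a)) (shellTarget g z₀.incl i) :=
      (continuousOn_extChartAt_symm z₀.incl).comp
        (contDiffOn_shellPoint g m z₀.incl i s).continuousOn
        fun a ha => shellPoint_mem_target g m z₀.incl i s ha
    exact (MassShell.isInducing_incl g m).continuousOn_iff.2
      (h1.congr fun a ha => incl_shellInv z₀ i s hs ha)

theorem exists_shellChart {g : LorentzianMetric d M} {m : ℝ} (hm : 0 < m) (z : MassShell g m) :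
    ∃ i s, ∃ hs : s = 1 ∨ s = -1, z ∈ (shellChart hm z i s hs).source := by
  have hz := mem_extChartAt_source (I := (𝓡 (d + 1)).tangent) z.incl
  by_contra hcon
  have h0 : (extChartAt (𝓡 (d + 1)).tangent z.incl z.incl).2 = 0 := by
    ext i
    by_contra hi
    rcases lt_or_gt_of_ne hi with h | h
    · exact hcon ⟨i, -1, Or.inr rfl, hz, by simpa using h⟩
    · exact hcon ⟨i, 1, Or.inl rfl, hz, by simpa using h⟩
  have hH := z.hamiltonian_eq
  rw [← PartialEquiv.left_inv _ hz, ← Prod.mk.eta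
    (p := extChartAt (𝓡 (d + 1)).tangent z.incl z.incl), h0,
    ← zero_smul ℝ (0 : EuclideanSpace ℝ (Fin (d + 1))), tangent_chart_symm_smul] at hH
  have : 0 < m ^ 2 := by positivity
  linarith

/-- The mass shell is a manifold of dimension `2d + 1`, with the charts `shellChart`. -/
noncomputable instance (g : LorentzianMetric d M) (m : ℝ) [hm : Fact (0 < m)] :
    ChartedSpace (EuclideanSpace ℝ (Fin (d + 1)) × EuclideanSpace ℝ (Fin d)) (MassShell g m) where
  atlas := {φ | ∃ z₀ i s, ∃ hs : s = 1 ∨ s = -1, φ = shellChart hm.out z₀ i s hs}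
  chartAt z := shellChart hm.out z (exists_shellChart hm.out z).choose
    (exists_shellChart hm.out z).choose_spec.choose
    (exists_shellChart hm.out z).choose_spec.choose_spec.choose
  mem_chart_source z := (exists_shellChart hm.out z).choose_spec.choose_spec.choose_spec
  chart_mem_atlas z := ⟨z, _, _, _, rfl⟩

instance (g : LorentzianMetric d M) (m : ℝ) [hm : Fact (0 < m)] :
    IsManifold 𝓘(ℝ, EuclideanSpace ℝ (Fin (d + 1)) × EuclideanSpace ℝ (Fin d)) ∞
      (MassShell g m) := by
  apply isManifold_of_contDiffOn
  rintro _ _ ⟨z₁, i₁, s₁, hs₁, rfl⟩ ⟨z₂, i₂, s₂, hs₂, rfl⟩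
  simp only [modelWithCornersSelf_coe, modelWithCornersSelf_coe_symm, Function.comp_id,
    Function.id_comp, Set.preimage_id, Set.range_id, Set.inter_univ]
  have h1 := contDiffOn_ext_coord_change (I := (𝓡 (d + 1)).tangent) (n := ∞) z₂.incl z₁.incl
  have hmem : ∀ a ∈ ((shellChart hm.out z₁ i₁ s₁ hs₁).symm ≫ₕ
      shellChart hm.out z₂ i₂ s₂ hs₂).source, a ∈ shellTarget g z₁.incl i₁ ∧
      (extChartAt (𝓡 (d + 1)).tangent z₁.incl).symm (shellPoint g m z₁.incl i₁ s₁ a) ∈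
        (extChartAt (𝓡 (d + 1)).tangent z₂.incl).source ∧
      0 < s₂ * (extChartAt (𝓡 (d + 1)).tangent z₂.incl
        ((extChartAt (𝓡 (d + 1)).tangent z₁.incl).symm
          (shellPoint g m z₁.incl i₁ s₁ a))).2 i₂ := by
    intro a ha
    rw [OpenPartialHomeomorph.trans_source] at ha
    have ha1 : a ∈ shellTarget g z₁.incl i₁ := ha.1
    refine ⟨ha1, ?_⟩
    rw [← incl_shellInv z₁ i₁ s₁ hs₁ ha1]
    exact ha.2
  have h2 : ContDiffOn ℝ ∞ (fun a => shellCoord i₂ ((extChartAt (𝓡 (d + 1)).tangent z₂.incl ∘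
      (extChartAt (𝓡 (d + 1)).tangent z₁.incl).symm) (shellPoint g m z₁.incl i₁ s₁ a)))
      ((shellChart hm.out z₁ i₁ s₁ hs₁).symm ≫ₕ shellChart hm.out z₂ i₂ s₂ hs₂).source := by
    refine (contDiffOn_shellCoord i₂).comp (h1.comp
      ((contDiffOn_shellPoint g m z₁.incl i₁ s₁).mono fun a ha => (hmem a ha).1) fun a ha => ?_)
      fun a ha => ne_zero_of_sign (hmem a ha).2.2
    exact ⟨shellPoint_mem_target g m z₁.incl i₁ s₁ (hmem a ha).1, (hmem a ha).2.1⟩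
  refine h2.congr fun a ha => ?_
  simp only [Function.comp_apply]
  rw [← incl_shellInv z₁ i₁ s₁ hs₁ (hmem a ha).1]
  rfl

end Charts
/-- The model with corners of the mass shell, a manifold of dimension `2d + 1` without boundary. -/
noncomputable abbrev shellModel (d : ℕ) : ModelWithCorners ℝ
    (EuclideanSpace ℝ (Fin (d + 1)) × EuclideanSpace ℝ (Fin d))
    (EuclideanSpace ℝ (Fin (d + 1)) × EuclideanSpace ℝ (Fin d)) :=
  𝓘(ℝ, EuclideanSpace ℝ (Fin (d + 1)) × EuclideanSpace ℝ (Fin d))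

/-- The inclusion `ι : Γ_m → TM` is smooth. -/
theorem MassShell.contMDiff_incl (g : LorentzianMetric d M) (m : ℝ) [hm : Fact (0 < m)] :
    ContMDiff (shellModel d) (𝓡 (d + 1)).tangent ∞ (MassShell.incl (g := g) (m := m)) := by
  intro z
  obtain ⟨i, s, hs, h⟩ : ∃ i s, ∃ hs : s = 1 ∨ s = -1,
      chartAt (EuclideanSpace ℝ (Fin (d + 1)) × EuclideanSpace ℝ (Fin d)) z =
        shellChart hm.out z i s hs := ⟨_, _, _, rfl⟩
  have h1 : ContMDiffOn (shellModel d) (𝓡 (d + 1)).tangent ∞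
      (fun a => (extChartAt (𝓡 (d + 1)).tangent z.incl).symm (shellPoint g m z.incl i s a))
      (shellTarget g z.incl i) :=
    (contMDiffOn_extChartAt_symm z.incl).comp
      (contDiffOn_shellPoint g m z.incl i s).contMDiffOn
      fun a ha => shellPoint_mem_target g m z.incl i s ha
  have h2 := contMDiffOn_chart (I := shellModel d) (n := ∞) (x := z)
  rw [h] at h2
  have h3 : z ∈ (shellChart hm.out z i s hs).source := h ▸ mem_chart_source _ z
  refine ((h1.comp h2 fun w hw => (shellChart hm.out z i s hs).map_source hw).congr
    fun w hw => ?_).contMDiffAt ((shellChart hm.out z i s hs).open_source.mem_nhds h3)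
  have h4 := incl_shellInv z i s hs ((shellChart hm.out z i s hs).map_source hw)
  rw [Function.comp_apply, ← h4]
  exact congrArg MassShell.incl ((shellChart hm.out z i s hs).left_inv hw).symm

/-- The inclusion `ι : Γ_m → TM` is an immersion. -/
theorem MassShell.injective_mfderiv_incl (g : LorentzianMetric d M) (m : ℝ) [hm : Fact (0 < m)]
    (z : MassShell g m) : Function.Injective
      (mfderiv (shellModel d) (𝓡 (d + 1)).tangent (MassShell.incl (g := g) (m := m)) z) := by
  obtain ⟨i, s, hs, h⟩ : ∃ i s, ∃ hs : s = 1 ∨ s = -1,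
      chartAt (EuclideanSpace ℝ (Fin (d + 1)) × EuclideanSpace ℝ (Fin d)) z =
        shellChart hm.out z i s hs := ⟨_, _, _, rfl⟩
  have h3 : z ∈ (shellChart hm.out z i s hs).source := h ▸ mem_chart_source _ z
  have hincl : MDifferentiableAt (shellModel d) (𝓡 (d + 1)).tangent
      (MassShell.incl (g := g) (m := m)) z :=
    (MassShell.contMDiff_incl g m z).mdifferentiableAt (by simp)
  have hcoord : MDifferentiableAt (𝓡 (d + 1)).tangent (shellModel d)
      (fun w => shellCoord i (extChartAt (𝓡 (d + 1)).tangent z.incl w)) z.incl := by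
    have h1 : ContDiffAt ℝ ∞ (shellCoord i) (extChartAt (𝓡 (d + 1)).tangent z.incl z.incl) := by
      refine (contDiffOn_shellCoord i).contDiffAt (IsOpen.mem_nhds ?_ (ne_zero_of_sign h3.2))
      exact isOpen_ne_fun (by fun_prop) continuous_const
    exact (h1.contMDiffAt.comp z.incl contMDiffAt_extChartAt).mdifferentiableAt (by simp)
  have hcomp := mfderiv_comp z hcoord hincl
  have hchart : (fun w => shellCoord i (extChartAt (𝓡 (d + 1)).tangent z.incl w)) ∘
      MassShell.incl (g := g) (m := m) = extChartAt (shellModel d) z := by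
    have : (extChartAt (shellModel d) z : MassShell g m → _) =
      chartAt (EuclideanSpace ℝ (Fin (d + 1)) × EuclideanSpace ℝ (Fin d)) z := by
      simp [extChartAt]
    rw [this, h]
    rfl
  rw [hchart] at hcomp
  have hinj : Function.Injective
      (mfderiv (shellModel d) (shellModel d) (extChartAt (shellModel d) z) z) :=
    (isInvertible_mfderiv_extChartAt (mem_extChartAt_source z)).injective
  intro v w hvw
  apply hinj
  rw [hcomp]
  exact congrArg (mfderiv (𝓡 (d + 1)).tangent (shellModel d)
    (fun w => shellCoord i (extChartAt (𝓡 (d + 1)).tangent z.incl w)) z.incl) hvw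

/-- The Liouville vector field, which is tangent to `Γ_m`, as a vector field on `Γ_m`: the
(unique) vector field on `Γ_m` whose push-forward under the inclusion is `L`. -/
noncomputable def shellLiouvilleField (g : LorentzianMetric d M) (A : Potential d M) (q m : ℝ)
    [Fact (0 < m)] (z : MassShell g m) : TangentSpace (shellModel d) z :=
  Classical.epsilon fun w =>
    mfderiv (shellModel d) (𝓡 (d + 1)).tangent MassShell.incl z w = liouvilleField g A q z.incl

/-- `σ` is a smooth `(2d + 1)`-form on the open set `{H < 0}` of the tangent bundle with
`dH ∧ σ = Λ` there (its values outside this set are irrelevant). -/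
def IsTransverseFactor (g : LorentzianMetric d M) (A : Potential d M) (q : ℝ)
    (σ : DiffForm (𝓡 (d + 1)).tangent (TangentBundle (𝓡 (d + 1)) M) (2 * d + 1)) : Prop :=
  SmoothFormOn σ {z | hamiltonian g z < 0} ∧
    ∀ z, hamiltonian g z < 0 → wedgeOne (dHamiltonian g z) (σ z) = tangentVolumeForm g A q z

/-- `Ω` is the induced volume form of the mass shell: the pull-back `Ω = ι^* σ` of a smooth form
`σ` on `{H < 0}` with `dH ∧ σ = Λ`. -/
def IsShellVolumeForm (g : LorentzianMetric d M) (A : Potential d M) (q m : ℝ) [Fact (0 < m)]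
    (Ω : DiffForm (shellModel d) (MassShell g m) (2 * d + 1)) : Prop :=
  ∃ σ, IsTransverseFactor g A q σ ∧ Ω = pullbackForm MassShell.incl σ

/-- The Lie derivative `£_X f = df(X)` of a function along a vector field on the mass shell. -/
noncomputable def shellLieDeriv {g : LorentzianMetric d M} {m : ℝ} [Fact (0 < m)]
    (X : Π z : MassShell g m, TangentSpace (shellModel d) z) (f : MassShell g m → ℝ)
    (z : MassShell g m) : ℝ :=
  mvfderiv (shellModel d) f z (X z)

end Spacetime

end RelKinetic

open RelKinetic

/-! The Legendre map `(x, p) ↦ (x, g(p, ·) + qA)`, read in a chart of `M`, pulls the canonical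
one-form of `E × E*` back to `Θ`. Hence `Ω_s` is locally the pull-back of a constant two-form
(`symplecticForm_eq_pullbackVec`). As `g` is non-degenerate, the Legendre map has invertible
differential, so `Ω_s` is non-degenerate and `L` exists.

Existence of `σ`: let `U` be the vertical lift of `p`, so that `dH(U) = 2H` and `i_U Ω_s = g(p, π_*
·)`. The form `dH ∧ Λ` vanishes for reasons of degree; contracting it with `U` gives `2H Λ = dH ∧
i_U Λ`, and `σ = (2H)⁻¹ i_U Λ` is a factor wherever `H < 0` (`wedgeOne_transverseFactor`).
Uniqueness of `Ω`: since `dH` vanishes on vectors tangent to `Γ_m`, `Ω(w) = Λ(u, ι_* w)` for any `u`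
with `dH(u) = 1`, whatever `σ` is (`IsShellVolumeForm.apply`).

With `i_L Ω_s = -dH` the same formula gives `i_L Ω = c n ι^*(Ω_s ∧ ⋯ ∧ Ω_s)`, with `d` factors and
`c` the constant in `Λ` (`IsShellVolumeForm.interiorProduct_eq`). So `ω` is locally the pull-back of
a constant form, hence smooth and closed, and `d(fω) = df ∧ ω`. Finally `df ∧ Ω = 0` by degree, and
contracting with `L` gives `df ∧ ω = df(L) Ω`. -/

namespace RelKinetic

/-! ### Contraction and wedge products of alternating forms -/

section AlternatingAlgebra

/-- A permutation is determined by the image `p` of `0` and a permutation `e` of the remaining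
indices; bringing `p` to the front is a cycle of sign `(-1) ^ p`. Applied twice, this splits off the
two arguments of one factor in a power of a two-form. -/
theorem sum_perm_succ {V : Type*} {n : ℕ} (F : (Fin (n + 1) → V) → ℝ) (v : Fin (n + 1) → V) :
    ∑ σ : Equiv.Perm (Fin (n + 1)), Equiv.Perm.sign σ • F (v ∘ σ) =
      ∑ p : Fin (n + 1), (-1 : ℝ) ^ (p : ℕ) *
        ∑ e : Equiv.Perm (Fin n), Equiv.Perm.sign e • F (Fin.cons (v p) (p.removeNth v ∘ e)) := by
  let D : Fin (n + 1) × Equiv.Perm (Fin n) → Equiv.Perm (Fin (n + 1)) := fun x =>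
    x.1.cycleRange.symm * Equiv.Perm.decomposeFin.symm (0, x.2)
  have h0 : ∀ x, D x 0 = x.1 := fun x => by simp [D]
  have hs : ∀ x k, D x (Fin.succ k) = x.1.succAbove (x.2 k) := fun x k => by simp [D]
  have hD : Function.Bijective D := by
    rw [Fintype.bijective_iff_injective_and_card]
    refine ⟨fun x y hxy => ?_, by simp [Fintype.card_perm, Nat.factorial_succ]⟩
    have h1 : x.1 = y.1 := by rw [← h0 x, ← h0 y, hxy]
    refine Prod.ext h1 (Equiv.ext fun k => ?_)
    have h2 : D x (Fin.succ k) = D y (Fin.succ k) := by rw [hxy]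
    rw [hs, hs, h1] at h2
    exact Fin.succAbove_right_injective h2
  rw [← hD.sum_comp, Fintype.sum_prod_type]
  refine Finset.sum_congr rfl fun p _ => ?_
  rw [Finset.mul_sum]
  refine Finset.sum_congr rfl fun e _ => ?_
  have hsign : Equiv.Perm.sign (D (p, e)) = (-1) ^ (p : ℕ) * Equiv.Perm.sign e := by
    simp [D, Fin.sign_cycleRange]
  have hF : v ∘ D (p, e) = Fin.cons (v p) (p.removeNth v ∘ e) := by
    funext k
    refine Fin.cases ?_ (fun k => ?_) k
    · simp [h0]
    · simp [hs, Fin.removeNth]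
  rw [hsign, hF, mul_smul]
  simp [Units.smul_def]

open AlternatingMap

variable {V : Type*} [AddCommGroup V] [Module ℝ V]

/-- The wedge product of a linear form with an alternating form. -/
noncomputable def wedgeLin {k : ℕ} (a : V →ₗ[ℝ] ℝ) :
    (V [⋀^Fin k]→ₗ[ℝ] ℝ) →ₗ[ℝ] V [⋀^Fin (k + 1)]→ₗ[ℝ] ℝ :=
  alternatizeUncurryFinLM ∘ₗ LinearMap.smulRightₗ a

theorem wedgeLin_apply {k : ℕ} (a : V →ₗ[ℝ] ℝ) (γ : V [⋀^Fin k]→ₗ[ℝ] ℝ) :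
    wedgeLin a γ = alternatizeUncurryFin (a.smulRight γ) := rfl

/-- The bilinear map `(x, y) ↦ a(y) F(x) + a(x) F(y)` is symmetric, so its double alternatization
vanishes; its two summands give the two sides. -/
theorem alternatizeUncurryFin_wedgeLin_comp {k : ℕ} (a : V →ₗ[ℝ] ℝ)
    (F : V →ₗ[ℝ] V [⋀^Fin k]→ₗ[ℝ] ℝ) :
    alternatizeUncurryFin (wedgeLin a ∘ₗ F) = - wedgeLin a (alternatizeUncurryFin F) := by
  let f₁ : V →ₗ[ℝ] V →ₗ[ℝ] V [⋀^Fin k]→ₗ[ℝ] ℝ := LinearMap.smulRightₗ a ∘ₗ F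
  let f₂ : V →ₗ[ℝ] V →ₗ[ℝ] V [⋀^Fin k]→ₗ[ℝ] ℝ := a.smulRight F
  have h := alternatizeUncurryFin_alternatizeUncurryFinLM_comp_of_symmetric (f := f₁ + f₂)
    fun x y => by simp [f₁, f₂, add_comm]
  rw [LinearMap.comp_add, alternatizeUncurryFin_add] at h
  have h1 : wedgeLin a ∘ₗ F = alternatizeUncurryFinLM ∘ₗ f₁ := rfl
  have h2 : wedgeLin a (alternatizeUncurryFin F) =
      alternatizeUncurryFin (alternatizeUncurryFinLM ∘ₗ f₂) := by
    rw [wedgeLin_apply]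
    congr 1
    ext x : 1
    simp [f₂]
  rw [h1, h2]
  exact eq_neg_of_add_eq_zero_left h

theorem wedgeLin_wedgeLin {k : ℕ} (a b : V →ₗ[ℝ] ℝ) (γ : V [⋀^Fin k]→ₗ[ℝ] ℝ) :
    wedgeLin a (wedgeLin b γ) = - wedgeLin b (wedgeLin a γ) := by
  have h := alternatizeUncurryFin_wedgeLin_comp a (b.smulRight γ)
  have h1 : wedgeLin a ∘ₗ b.smulRight γ = b.smulRight (wedgeLin a γ) := by
    ext x : 1
    simp
  rw [h1, ← wedgeLin_apply, ← wedgeLin_apply] at h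
  rw [h, neg_neg]

/-- The term of index `0` in the alternating sum is `F v`. In every other term `v` stays in the
first slot of the form, and the shift of the index by one produces the minus sign. -/
theorem curryLeft_alternatizeUncurryFin {k : ℕ} (F : V →ₗ[ℝ] V [⋀^Fin (k + 1)]→ₗ[ℝ] ℝ) (v : V) :
    (alternatizeUncurryFin F).curryLeft v =
      F v - alternatizeUncurryFin (curryLeftLinearMap.flip v ∘ₗ F) := by
  ext w
  have hcons : ∀ i : Fin (k + 1), (Fin.succ i).removeNth (Matrix.vecCons v w) =
      Matrix.vecCons v (i.removeNth w) := fun i => by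
    funext j
    refine Fin.cases ?_ (fun j => ?_) j <;> simp [Fin.removeNth]
  have hcons0 : (0 : Fin (k + 2)).removeNth (Matrix.vecCons v w) = w := by
    funext j
    simp [Fin.removeNth]
  simp only [curryLeft_apply_apply, AlternatingMap.sub_apply, alternatizeUncurryFin_apply]
  rw [Fin.sum_univ_succ, sub_eq_add_neg, ← Finset.sum_neg_distrib]
  congr 1
  · simp [hcons0]
  · refine Finset.sum_congr rfl fun i _ => ?_
    rw [hcons]
    simp [pow_succ]

theorem curryLeft_wedgeLin {k : ℕ} (a : V →ₗ[ℝ] ℝ) (γ : V [⋀^Fin (k + 1)]→ₗ[ℝ] ℝ) (v : V) :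
    (wedgeLin a γ).curryLeft v = a v • γ - wedgeLin a (γ.curryLeft v) := by
  rw [wedgeLin_apply, curryLeft_alternatizeUncurryFin, wedgeLin_apply]
  congr 2

/-- A form of degree `0` has no contraction, so the base case of the antiderivation rule is
separate. -/
theorem curryLeft_wedgeLin_zero (a : V →ₗ[ℝ] ℝ) (γ : V [⋀^Fin 0]→ₗ[ℝ] ℝ) (v : V) :
    (wedgeLin a γ).curryLeft v = a v • γ := by
  ext w
  simp only [curryLeft_apply_apply, wedgeLin_apply, alternatizeUncurryFin_apply]
  simp [Subsingleton.elim (Fin.removeNth 0 (Matrix.vecCons v w)) w]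

/-- The linear map `x ↦ b(x, ·) ∧ γ`. -/
noncomputable def wedgeBilin {k : ℕ} (b : V →ₗ[ℝ] V →ₗ[ℝ] ℝ) (γ : V [⋀^Fin k]→ₗ[ℝ] ℝ) :
    V →ₗ[ℝ] V [⋀^Fin (k + 1)]→ₗ[ℝ] ℝ where
  toFun x := wedgeLin (b x) γ
  map_add' x y := by
    rw [map_add, wedgeLin_apply, wedgeLin_apply, wedgeLin_apply, ← alternatizeUncurryFin_add]
    congr 1
    ext z : 1
    simp [add_smul]
  map_smul' c x := by
    rw [map_smul, wedgeLin_apply, wedgeLin_apply, RingHom.id_apply, ← alternatizeUncurryFin_smul]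
    congr 1
    ext z : 1
    simp [mul_smul]

@[simp]
theorem wedgeBilin_apply {k : ℕ} (b : V →ₗ[ℝ] V →ₗ[ℝ] ℝ) (γ : V [⋀^Fin k]→ₗ[ℝ] ℝ) (x : V) :
    wedgeBilin b γ x = wedgeLin (b x) γ := rfl

theorem alternatizeUncurryFin_smul_left {k : ℕ} {b : V →ₗ[ℝ] V →ₗ[ℝ] ℝ}
    (hb : ∀ x y, b x y = - b y x) (γ : V [⋀^Fin k]→ₗ[ℝ] ℝ) (v : V) :
    alternatizeUncurryFin ((b.flip v).smulRight γ) = - wedgeLin (b v) γ := by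
  rw [wedgeLin_apply, ← neg_one_smul ℝ (alternatizeUncurryFin _), ← alternatizeUncurryFin_smul]
  congr 1
  ext x : 1
  simp [hb x v]

theorem curryLeft_wedgeBilin_zero {b : V →ₗ[ℝ] V →ₗ[ℝ] ℝ} (hb : ∀ x y, b x y = - b y x)
    (γ : V [⋀^Fin 0]→ₗ[ℝ] ℝ) (v : V) :
    (alternatizeUncurryFin (wedgeBilin b γ)).curryLeft v = (2 : ℝ) • wedgeLin (b v) γ := by
  have h : curryLeftLinearMap.flip v ∘ₗ wedgeBilin b γ = (b.flip v).smulRight γ := by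
    ext x : 1
    simp [curryLeft_wedgeLin_zero]
  rw [curryLeft_alternatizeUncurryFin, h, alternatizeUncurryFin_smul_left hb, wedgeBilin_apply,
    two_smul, sub_neg_eq_add]

/-- For the two-form `β` given by `b`, alternatizing `wedgeBilin b γ` gives `2 β ∧ γ`, so this is
the inductive step for contracting a power of `β`. Contracting either argument of `b` yields one
copy of `b(v, ·) ∧ γ`, whence the `2`. In the last term the signs cancel, one of them from
exchanging `b(x, ·)` with `b(v, ·)`. -/
theorem curryLeft_wedgeBilin_succ {k : ℕ} {b : V →ₗ[ℝ] V →ₗ[ℝ] ℝ} (hb : ∀ x y, b x y = - b y x)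
    (γ : V [⋀^Fin (k + 1 + 1)]→ₗ[ℝ] ℝ) (δ : V [⋀^Fin k]→ₗ[ℝ] ℝ) (v : V) (c : ℝ)
    (h : γ.curryLeft v = c • wedgeLin (b v) δ) :
    (alternatizeUncurryFin (wedgeBilin b γ)).curryLeft v =
      (2 : ℝ) • wedgeLin (b v) γ + c • wedgeLin (b v) (alternatizeUncurryFin (wedgeBilin b δ)) := by
  have h1 : curryLeftLinearMap.flip v ∘ₗ wedgeBilin b γ =
      (b.flip v).smulRight γ + c • wedgeLin (b v) ∘ₗ wedgeBilin b δ := by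
    ext x : 1
    simp [curryLeft_wedgeLin, h, wedgeLin_wedgeLin (b x) (b v)]
  rw [curryLeft_alternatizeUncurryFin, h1, alternatizeUncurryFin_add,
    alternatizeUncurryFin_smul_left hb, alternatizeUncurryFin_smul,
    alternatizeUncurryFin_wedgeLin_comp, wedgeBilin_apply, two_smul, smul_neg]
  abel

end AlternatingAlgebra

/-! ### Powers of a two-form and their contractions -/

section WedgePow

variable {V : Type*} [AddCommGroup V] [Module ℝ V] [TopologicalSpace V]

/-- The bilinear map underlying a `2`-covector. -/
noncomputable def twoFormBilin (β : V [⋀^Fin 2]→L[ℝ] ℝ) : V →ₗ[ℝ] V →ₗ[ℝ] ℝ :=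
  LinearMap.mk₂ ℝ (fun x y => β ![x, y])
    (fun x x' y => β.toAlternatingMap.map_vecCons_add ![y] x x')
    (fun c x y => β.toAlternatingMap.map_vecCons_smul ![y] c x)
    (fun x y y' => by
      have := (β.toAlternatingMap.curryLeft x).map_vecCons_add ![] y y'
      exact this)
    (fun c x y => by
      have := (β.toAlternatingMap.curryLeft x).map_vecCons_smul ![] c y
      exact this)

@[simp]
theorem twoFormBilin_apply (β : V [⋀^Fin 2]→L[ℝ] ℝ) (x y : V) :
    twoFormBilin β x y = β ![x, y] := rfl

theorem twoForm_swap (β : V [⋀^Fin 2]→L[ℝ] ℝ) (x y : V) : β ![x, y] = - β ![y, x] := by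
  have h := β.toAlternatingMap.map_swap ![y, x] (i := 0) (j := 1) (by simp)
  have h1 : ![y, x] ∘ Equiv.swap (0 : Fin 2) 1 = ![x, y] := by
    funext i
    fin_cases i <;> simp
  rw [h1] at h
  exact h

theorem wedgePow_apply {n N : ℕ} (h : 2 * n = N) (β : V [⋀^Fin 2]→L[ℝ] ℝ) (v : Fin N → V) :
    wedgePow h β v = ((2 : ℝ) ^ n)⁻¹ * ∑ σ : Equiv.Perm (Fin N),
      Equiv.Perm.sign σ • pairProduct h β (v ∘ σ) := by
  simp [wedgePow, ContinuousMultilinearMap.alternatization_apply_apply]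

theorem pairProduct_cons_cons {n N : ℕ} (h : 2 * n = N) (h' : 2 * (n + 1) = N + 1 + 1)
    (β : V [⋀^Fin 2]→L[ℝ] ℝ) (x y : V) (v : Fin N → V) :
    pairProduct h' β (Fin.cons x (Fin.cons y v : Fin (N + 1) → V)) =
      β ![x, y] * pairProduct h β v := by
  change (∏ i : Fin (n + 1), _) = _ * ∏ i : Fin n, _
  rw [Fin.prod_univ_succ]
  rfl

/-- This is `β^(n+1) = β ∧ β^n`. Expanding the permutation sum over the first two positions leaves
the sum that defines `β^n`; each unordered pair occurs in both orders, which the factor `2⁻¹`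
compensates. -/
theorem wedgePow_succ {n N : ℕ} (h : 2 * n = N) (h' : 2 * (n + 1) = N + 1 + 1)
    (β : V [⋀^Fin 2]→L[ℝ] ℝ) :
    (wedgePow h' β).toAlternatingMap = (2⁻¹ : ℝ) • AlternatingMap.alternatizeUncurryFin
      (wedgeBilin (twoFormBilin β) (wedgePow h β).toAlternatingMap) := by
  ext v
  change wedgePow h' β v = _
  simp only [AlternatingMap.smul_apply, AlternatingMap.alternatizeUncurryFin_apply,
    wedgeBilin_apply, wedgeLin_apply, LinearMap.smulRight_apply]
  rw [wedgePow_apply, sum_perm_succ, smul_eq_mul, Finset.mul_sum, Finset.mul_sum]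
  refine Finset.sum_congr rfl fun p _ => ?_
  have h1 := sum_perm_succ (fun w => pairProduct h' β (Fin.cons (v p) w)) (p.removeNth v)
  simp only [pairProduct_cons_cons h h'] at h1
  rw [h1]
  simp only [twoFormBilin_apply, zsmul_eq_mul, Int.cast_pow,
    Int.cast_neg, Int.cast_one, smul_eq_mul]
  rw [mul_left_comm, mul_left_comm (2⁻¹ : ℝ)]
  congr 1
  rw [Finset.mul_sum, Finset.mul_sum]
  refine Finset.sum_congr rfl fun k _ => ?_
  change _ = _ * (_ * (_ * wedgePow h β _))
  rw [wedgePow_apply]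
  have h2 : ∀ e : Equiv.Perm (Fin N), Equiv.Perm.sign e •
      (β ![v p, p.removeNth v k] * pairProduct h β (k.removeNth (p.removeNth v) ∘ e)) =
      β ![v p, p.removeNth v k] *
        Equiv.Perm.sign e • pairProduct h β (k.removeNth (p.removeNth v) ∘ e) := fun e => by
    simp only [Units.smul_def, zsmul_eq_mul]
    ring
  simp only [h2, ← Finset.mul_sum]
  rw [pow_succ, mul_inv]
  ring

theorem curryLeft_wedgePow {n N : ℕ} (h : 2 * n = N) (h' : 2 * (n + 1) = N + 1 + 1)
    (β : V [⋀^Fin 2]→L[ℝ] ℝ) (v : V) :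
    (wedgePow h' β).toAlternatingMap.curryLeft v =
      ((n : ℝ) + 1) • wedgeLin (twoFormBilin β v) (wedgePow h β).toAlternatingMap := by
  induction n generalizing N with
  | zero =>
    obtain rfl : 0 = N := by omega
    rw [wedgePow_succ h h', AlternatingMap.curryLeft_smul, LinearMap.smul_apply,
      curryLeft_wedgeBilin_zero (twoForm_swap β), smul_smul]
    norm_num
  | succ n ih =>
    obtain rfl : 2 * n + 1 + 1 = N := by omega
    have h2 := ih rfl h
    rw [wedgePow_succ h h', AlternatingMap.curryLeft_smul, LinearMap.smul_apply,
      curryLeft_wedgeBilin_succ (twoForm_swap β) _ _ _ _ h2]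
    -- The remaining alternatization is twice the next power of `β`, so the total coefficient is
    -- `2⁻¹ (2 + 2 (n + 1)) = n + 2`.
    have h3 := wedgePow_succ rfl h β
    rw [← inv_smul_eq_iff₀ (by norm_num : (2⁻¹ : ℝ) ≠ 0)] at h3
    rw [← h3, map_smul]
    push_cast
    module

/-- `i_v (β ∧ ⋯ ∧ β) = n (i_v β) ∧ β ∧ ⋯ ∧ β`. -/
theorem interiorProduct_wedgePow {n N : ℕ} (h : 2 * n = N) (h' : 2 * (n + 1) = N + 1 + 1)
    (β : V [⋀^Fin 2]→L[ℝ] ℝ) (v : V) (a : V →L[ℝ] ℝ) (ha : ∀ u, a u = β ![v, u]) :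
    interiorProduct v (wedgePow h' β) = ((n : ℝ) + 1) • wedgeOne a (wedgePow h β) := by
  have h1 : twoFormBilin β v = a := LinearMap.ext fun u => (ha u).symm
  have h2 := curryLeft_wedgePow h h' β v
  rw [h1] at h2
  exact ContinuousAlternatingMap.toAlternatingMap_injective h2

/-- `i_v (a ∧ γ) = a(v) γ - a ∧ i_v γ`. -/
theorem interiorProduct_wedgeOne {k : ℕ} (a : V →L[ℝ] ℝ) (γ : V [⋀^Fin (k + 1)]→L[ℝ] ℝ) (v : V) :
    interiorProduct v (wedgeOne a γ) = a v • γ - wedgeOne a (interiorProduct v γ) :=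
  ContinuousAlternatingMap.toAlternatingMap_injective
    (curryLeft_wedgeLin (a : V →ₗ[ℝ] ℝ) γ.toAlternatingMap v)

theorem wedgeOne_smul {k : ℕ} (a : V →L[ℝ] ℝ) (γ : V [⋀^Fin k]→L[ℝ] ℝ) (c : ℝ) :
    wedgeOne a (c • γ) = c • wedgeOne a γ :=
  ContinuousAlternatingMap.toAlternatingMap_injective
    (map_smul (wedgeLin (a : V →ₗ[ℝ] ℝ)) c γ.toAlternatingMap)

/-- Used for `dH ∧ Λ = 0` on `TM` and `df ∧ Ω = 0` on the mass shell, the two identities that are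
then contracted. -/
theorem eq_zero_of_finrank_lt {k : ℕ} [FiniteDimensional ℝ V] (hk : Module.finrank ℝ V < k)
    (γ : V [⋀^Fin k]→L[ℝ] ℝ) : γ = 0 := by
  ext v
  refine γ.toAlternatingMap.map_linearDependent v fun hv => ?_
  have := hv.fintype_card_le_finrank
  simp at this
  omega

/-- If `a` vanishes on the vectors `w`, then `(a ∧ γ)(u, w) = a(u) γ(w)`. -/
theorem wedgeOne_cons_of_forall_eq_zero {k : ℕ} (a : V →L[ℝ] ℝ) (γ : V [⋀^Fin k]→L[ℝ] ℝ) (u : V)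
    (w : Fin k → V) (hw : ∀ i, a (w i) = 0) :
    wedgeOne a γ (Fin.cons u w : Fin (k + 1) → V) = a u * γ w := by
  rw [wedgeOne_apply, Fin.sum_univ_succ]
  simp [hw]

variable {V' : Type*} [AddCommGroup V'] [Module ℝ V'] [TopologicalSpace V']

theorem wedgeOne_comp {k : ℕ} (a : V →L[ℝ] ℝ) (γ : V [⋀^Fin k]→L[ℝ] ℝ) (f : V' →L[ℝ] V) :
    (wedgeOne a γ).compContinuousLinearMap f =
      wedgeOne (a.comp f) (γ.compContinuousLinearMap f) := by
  ext v
  simp only [ContinuousAlternatingMap.compContinuousLinearMap_apply, wedgeOne_apply]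
  rfl

theorem wedgePow_comp {n N : ℕ} (h : 2 * n = N) (β : V [⋀^Fin 2]→L[ℝ] ℝ) (f : V' →L[ℝ] V) :
    (wedgePow h β).compContinuousLinearMap f =
      wedgePow h (β.compContinuousLinearMap f) := by
  ext v
  simp only [ContinuousAlternatingMap.compContinuousLinearMap_apply, wedgePow_apply]
  congr 1
  refine Finset.sum_congr rfl fun σ _ => ?_
  congr 1
  change (∏ i : Fin n, β _) = ∏ i : Fin n, β _
  refine Finset.prod_congr rfl fun i _ => ?_
  congr 1
  funext j
  fin_cases j <;> rfl

end WedgePow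

/-! ### Smooth dependence of a pull-back on the form and on the linear map -/

section SmoothComp

variable {E G : Type*} [NormedAddCommGroup E] [NormedSpace ℝ E] [NormedAddCommGroup G]
  [NormedSpace ℝ G] {k : ℕ}

/-- Alternatization as a continuous linear map. -/
noncomputable def alternatizationCLM (k : ℕ) (E : Type*) [NormedAddCommGroup E] [NormedSpace ℝ E] :
    ContinuousMultilinearMap ℝ (fun _ : Fin k => E) ℝ →L[ℝ] E [⋀^Fin k]→L[ℝ] ℝ :=
  LinearMap.mkContinuous
    { toFun := fun f => ContinuousMultilinearMap.alternatization f
      map_add' := map_add _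
      map_smul' := fun c f => by
        ext v
        simp [ContinuousMultilinearMap.alternatization_apply_apply, Finset.mul_sum,
          Units.smul_def, mul_left_comm] }
    (Fintype.card (Equiv.Perm (Fin k))) fun f => by
      refine ContinuousAlternatingMap.opNorm_le_bound _ (by positivity) fun v => ?_
      change ‖ContinuousMultilinearMap.alternatization f v‖ ≤ _
      rw [ContinuousMultilinearMap.alternatization_apply_apply]
      refine (norm_sum_le _ _).trans ?_
      rw [← Finset.card_univ, mul_assoc, ← nsmul_eq_mul]
      refine Finset.sum_le_card_nsmul _ _ _ fun σ _ => ?_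
      have h1 : ‖Equiv.Perm.sign σ • f (v ∘ σ)‖ = ‖f (v ∘ σ)‖ := by
        rcases Int.units_eq_one_or (Equiv.Perm.sign σ) with h | h <;> simp [h]
      rw [h1, ← Equiv.prod_comp σ fun i => ‖v i‖]
      exact f.le_opNorm _

theorem alternatizationCLM_coe (f : E [⋀^Fin k]→L[ℝ] ℝ) :
    alternatizationCLM k E f.toContinuousMultilinearMap = (k.factorial : ℝ) • f := by
  ext v
  change ContinuousMultilinearMap.alternatization f.toContinuousMultilinearMap v = _
  rw [ContinuousMultilinearMap.alternatization_apply_apply]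
  have h : ∀ σ : Equiv.Perm (Fin k),
      Equiv.Perm.sign σ • f.toContinuousMultilinearMap (v ∘ σ) = f v := fun σ => by
    have h1 := f.toAlternatingMap.map_perm v σ
    change f (v ∘ σ) = Equiv.Perm.sign σ • f v at h1
    change Equiv.Perm.sign σ • f (v ∘ σ) = _
    rw [h1, smul_smul, Int.units_mul_self, one_smul]
  rw [Finset.sum_congr rfl fun σ _ => h σ]
  simp [Fintype.card_perm]

/-- For multilinear maps the pull-back is linear in the form and multilinear in the linear map,
hence smooth in both. Alternatization divided by `k!` is a continuous linear way back to alternating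
maps. -/
theorem contDiff_compContinuousLinearMap :
    ContDiff ℝ ∞ (fun p : (G [⋀^Fin k]→L[ℝ] ℝ) × (E →L[ℝ] G) =>
      p.1.compContinuousLinearMap p.2) := by
  have h1 : (fun p : (G [⋀^Fin k]→L[ℝ] ℝ) × (E →L[ℝ] G) => p.1.compContinuousLinearMap p.2) =
      fun p => (k.factorial : ℝ)⁻¹ • alternatizationCLM k E
        (ContinuousMultilinearMap.compContinuousLinearMapContinuousMultilinear ℝ
          (fun _ : Fin k => E) (fun _ : Fin k => G) ℝ (fun _ => p.2)
          p.1.toContinuousMultilinearMap) := by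
    funext p
    have := alternatizationCLM_coe (p.1.compContinuousLinearMap p.2)
    rw [eq_inv_smul_iff₀ (by exact_mod_cast k.factorial_ne_zero), ← this]
    rfl
  rw [h1]
  have h2 : ContDiff ℝ ∞ (fun p : (G [⋀^Fin k]→L[ℝ] ℝ) × (E →L[ℝ] G) =>
      p.1.toContinuousMultilinearMap) :=
    (ContinuousAlternatingMap.toContinuousMultilinearMapCLM (𝕜 := ℝ) (E := G) (F := ℝ)
      (ι := Fin k) ℝ).contDiff.comp contDiff_fst
  have h3 : ContDiff ℝ ∞ (fun p : (G [⋀^Fin k]→L[ℝ] ℝ) × (E →L[ℝ] G) =>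
      ContinuousMultilinearMap.compContinuousLinearMapContinuousMultilinear ℝ
          (fun _ : Fin k => E) (fun _ : Fin k => G) ℝ (fun _ => p.2)) :=
    (ContinuousMultilinearMap.contDiff _).comp (contDiff_pi.2 fun _ => contDiff_snd)
  exact ((alternatizationCLM k E).contDiff.comp (h3.clm_apply h2)).const_smul _

end SmoothComp

/-! ### Forms on a manifold that are locally pulled back from a normed space -/

section LocalPullback

open scoped Topology

variable {E : Type*} [NormedAddCommGroup E] [NormedSpace ℝ E]
  {H : Type*} [TopologicalSpace H] {I : ModelWithCorners ℝ E H} [I.Boundaryless]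
  {N : Type*} [TopologicalSpace N] [ChartedSpace H N] [IsManifold I ∞ N]
  {G : Type*} [NormedAddCommGroup G] [NormedSpace ℝ G] {k : ℕ}

/-- The pull-back of a form on a normed space under a map from a manifold. -/
noncomputable def pullbackVec (I : ModelWithCorners ℝ E H) (F : N → G)
    (β : G → G [⋀^Fin k]→L[ℝ] ℝ) : DiffForm I N k := fun x =>
  (β (F x)).compContinuousLinearMap (mvfderiv I F x)

omit [I.Boundaryless] in
theorem eventually_mdifferentiableAt {F : N → G} {z : N} (hF : ContMDiffAt I 𝓘(ℝ, G) ∞ F z) :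
    ∀ᶠ x in 𝓝 z, MDifferentiableAt I 𝓘(ℝ, G) F x := by
  have : IsManifold I 1 N := IsManifold.of_le (n := ∞) (by simp)
  have h1 : ContMDiffAt I 𝓘(ℝ, G) 1 F z := hF.of_le (by simp)
  exact ((contMDiffAt_iff_contMDiffAt_nhds (by simp)).1 h1).mono
    fun x hx => hx.mdifferentiableAt (by simp)

omit [I.Boundaryless] [IsManifold I ∞ N] in
theorem mvfderiv_clm_comp {G' : Type*} [NormedAddCommGroup G'] [NormedSpace ℝ G'] {F : N → G}
    {z : N} (hF : MDifferentiableAt I 𝓘(ℝ, G) F z) (T : G →L[ℝ] G') (X : TangentSpace I z) :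
    mvfderiv I (fun x => T (F x)) z X = T (mvfderiv I F z X) := by
  have h := mfderiv_comp (I' := 𝓘(ℝ, G)) z (T.mdifferentiableAt (x := F z)) hF
  rw [ContinuousLinearMap.mfderiv_eq] at h
  exact congrArg (fun S => S X) h

omit [I.Boundaryless] [IsManifold I ∞ N] in
theorem mvfderiv_prodMk {G' : Type*} [NormedAddCommGroup G'] [NormedSpace ℝ G'] {F : N → G}
    {F' : N → G'} {z : N} (hF : MDifferentiableAt I 𝓘(ℝ, G) F z)
    (hF' : MDifferentiableAt I 𝓘(ℝ, G') F' z) :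
    mvfderiv I (fun x => (F x, F' x)) z = (mvfderiv I F z).prod (mvfderiv I F' z) := by
  rw [mvfderiv, modelWithCornersSelf_prod, ← chartedSpaceSelf_prod]
  rw [hF.mfderiv_prod hF']
  rfl

/-- The chain rule turns the chart expression into an ordinary pull-back between normed spaces. -/
theorem formInChart_pullbackVec {α : DiffForm I N k} {F : N → G} {β : G → G [⋀^Fin k]→L[ℝ] ℝ}
    {x₀ : N} {y : E} (hy : y ∈ (extChartAt I x₀).target)
    (hα : α ((extChartAt I x₀).symm y) = pullbackVec I F β ((extChartAt I x₀).symm y))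
    (hF : MDifferentiableAt I 𝓘(ℝ, G) F ((extChartAt I x₀).symm y)) :
    formInChart α x₀ y = (β ((F ∘ (extChartAt I x₀).symm) y)).compContinuousLinearMap
      (fderiv ℝ (F ∘ (extChartAt I x₀).symm) y) := by
  have h1 : MDifferentiableAt 𝓘(ℝ, E) I (extChartAt I x₀).symm y :=
    ((contMDiffOn_extChartAt_symm (n := ∞) x₀).contMDiffAt
      ((isOpen_extChartAt_target x₀).mem_nhds hy)).mdifferentiableAt (by simp)
  rw [formInChart, hα, ← mfderiv_eq_fderiv, mfderiv_comp y hF h1]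
  rfl

theorem eventually_formInChart {α : DiffForm I N k} {F : N → G} {β : G → G [⋀^Fin k]→L[ℝ] ℝ}
    {x₀ : N} {y : E} (hy : y ∈ (extChartAt I x₀).target)
    (hα : ∀ᶠ x in 𝓝 ((extChartAt I x₀).symm y), α x = pullbackVec I F β x)
    (hF : ContMDiffAt I 𝓘(ℝ, G) ∞ F ((extChartAt I x₀).symm y)) :
    formInChart α x₀ =ᶠ[𝓝 y] fun y => (β ((F ∘ (extChartAt I x₀).symm) y)).compContinuousLinearMap
      (fderiv ℝ (F ∘ (extChartAt I x₀).symm) y) := by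
  have h1 : ∀ᶠ x in 𝓝 ((extChartAt I x₀).symm y), MDifferentiableAt I 𝓘(ℝ, G) F x :=
    eventually_mdifferentiableAt hF
  have h2 : ContinuousAt (extChartAt I x₀).symm y := continuousAt_extChartAt_symm'' hy
  filter_upwards [h2.eventually hα, h2.eventually h1, (isOpen_extChartAt_target x₀).mem_nhds hy]
    with y' h3 h4 h5 using formInChart_pullbackVec h5 h3 h4

theorem contDiffAt_comp_extChartAt_symm {F : N → G} {x₀ : N} {y : E}
    (hy : y ∈ (extChartAt I x₀).target)
    (hF : ContMDiffAt I 𝓘(ℝ, G) ∞ F ((extChartAt I x₀).symm y)) :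
    ContDiffAt ℝ ∞ (F ∘ (extChartAt I x₀).symm) y := by
  rw [← contMDiffAt_iff_contDiffAt]
  exact hF.comp y ((contMDiffOn_extChartAt_symm (n := ∞) x₀).contMDiffAt
      ((isOpen_extChartAt_target x₀).mem_nhds hy))

/-- The exterior derivative commutes with pull-back. -/
theorem mExtDeriv_eq_pullbackVec {α : DiffForm I N k} {F : N → G} {β : G → G [⋀^Fin k]→L[ℝ] ℝ}
    {z : N} (hα : ∀ᶠ x in 𝓝 z, α x = pullbackVec I F β x) (hF : ContMDiffAt I 𝓘(ℝ, G) ∞ F z)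
    (hβ : DifferentiableAt ℝ β (F z)) :
    mExtDeriv α z = pullbackVec I F (extDeriv β) z := by
  have hz := mem_extChartAt_source (I := I) z
  have hy := mem_extChartAt_target (I := I) z
  have hzz : (extChartAt I z).symm (extChartAt I z z) = z := extChartAt_to_inv z
  have hF' : ContMDiffAt I 𝓘(ℝ, G) ∞ F ((extChartAt I z).symm (extChartAt I z z)) := by rwa [hzz]
  have h1 := eventually_formInChart hy (by rwa [hzz]) hF'
  have h2 := contDiffAt_comp_extChartAt_symm hy hF'
  have h3 : mfderiv I 𝓘(ℝ, G) F z =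
      (fderiv ℝ (F ∘ (extChartAt I z).symm) (extChartAt I z z)).comp
        (mfderiv I 𝓘(ℝ, E) (extChartAt I z) z) := by
    -- Near `z` the map `F` factors through the chart, so its differential is that of its chart
    -- expression composed with that of the chart.
    have h4 : F =ᶠ[𝓝 z] (F ∘ (extChartAt I z).symm) ∘ extChartAt I z := by
      filter_upwards [(isOpen_extChartAt_source (I := I) z).mem_nhds hz] with x hx
      simp only [Function.comp_apply, (extChartAt I z).left_inv hx]
    rw [h4.mfderiv_eq, mfderiv_comp z
      ((h2.differentiableAt (by simp)).mdifferentiableAt)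
      ((contMDiffAt_extChartAt (n := ∞)).mdifferentiableAt (by simp)), mfderiv_eq_fderiv]
    rfl
  have hFz : (F ∘ (extChartAt I z).symm) (extChartAt I z z) = F z := by simp
  rw [mExtDeriv, h1.extDeriv_eq, extDeriv_pullback (r := ∞) (by rwa [hFz]) h2
    (by simpa using WithTop.coe_le_coe.2 (le_top (a := (2 : ℕ∞)))), pullbackVec, mvfderiv, h3, hFz]
  rfl

/-- In a chart the form is built from `β ∘ F` and the derivative of `F` by the pull-back operation,
which is jointly smooth. The map and the model form may change from point to point. -/
theorem smoothFormOn_of_pullbackVec {α : DiffForm I N k} {U : Set N}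
    (h : ∀ z ∈ U, ∃ (F : N → G) (β : G → G [⋀^Fin k]→L[ℝ] ℝ),
      (∀ᶠ x in 𝓝 z, α x = pullbackVec I F β x) ∧ ContMDiffAt I 𝓘(ℝ, G) ∞ F z ∧
      ContDiffAt ℝ ∞ β (F z)) : SmoothFormOn α U := by
  rintro x₀ y ⟨hy, hyU⟩
  obtain ⟨F, β, hα, hF, hβ⟩ := h _ hyU
  have h2 := contDiffAt_comp_extChartAt_symm hy hF
  refine (ContDiffAt.congr_of_eventuallyEq ?_ (eventually_formInChart hy hα hF)).contDiffWithinAt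
  have h3 : ContDiffAt ℝ ∞ (fderiv ℝ (F ∘ (extChartAt I x₀).symm)) y :=
    h2.fderiv_right (by simp)
  have h4 : ContDiffAt ℝ ∞ (fun y => β ((F ∘ (extChartAt I x₀).symm) y)) y :=
    ContDiffAt.comp y hβ h2
  exact contDiff_compContinuousLinearMap.contDiffAt.comp y (h4.prodMk h3)

omit [I.Boundaryless] [IsManifold I ∞ N] in
theorem pullbackVec_comp_incl {E' : Type*} [NormedAddCommGroup E'] [NormedSpace ℝ E']
    {H' : Type*} [TopologicalSpace H'] {I' : ModelWithCorners ℝ E' H'}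
    {N' : Type*} [TopologicalSpace N'] [ChartedSpace H' N'] {i : N' → N} {F : N → G}
    {β : G → G [⋀^Fin k]→L[ℝ] ℝ} {z : N'} (hi : MDifferentiableAt I' I i z)
    (hF : MDifferentiableAt I 𝓘(ℝ, G) F (i z)) :
    (pullbackVec I F β (i z)).compContinuousLinearMap (mfderiv I' I i z) =
      pullbackVec I' (F ∘ i) β z := by
  rw [pullbackVec, pullbackVec, mvfderiv, mvfderiv, mfderiv_comp z hF hi]
  rfl

/-- `d(f ω) = df ∧ ω` if `ω` is locally the pull-back of a constant form. -/
theorem mExtDeriv_smul_const {α : DiffForm I N k} {F : N → G} {C : G [⋀^Fin k]→L[ℝ] ℝ}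
    {f : N → ℝ} {z : N} (hα : ∀ᶠ x in 𝓝 z, α x = pullbackVec I F (fun _ => C) x)
    (hF : ContMDiffAt I 𝓘(ℝ, G) ∞ F z) (hf : ContMDiffAt I 𝓘(ℝ, ℝ) ∞ f z) :
    mExtDeriv (fun x => f x • α x) z = wedgeOne (mvfderiv I f z) (α z) := by
  -- Near `z`, `f • F^* C` is the pull-back under `(f, F)` of the form `t C` on `ℝ × G`. That form
  -- is linear in the point, with exterior derivative `dt ∧ C`.
  let C' : (ℝ × G) [⋀^Fin k]→L[ℝ] ℝ := C.compContinuousLinearMap (ContinuousLinearMap.snd ℝ ℝ G)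
  let β : (ℝ × G) →L[ℝ] (ℝ × G) [⋀^Fin k]→L[ℝ] ℝ := (ContinuousLinearMap.fst ℝ ℝ G).smulRight C'
  have hmd : ∀ᶠ x in 𝓝 z, MDifferentiableAt I 𝓘(ℝ, G) F x :=
    eventually_mdifferentiableAt hF
  have hmf : ∀ᶠ x in 𝓝 z, MDifferentiableAt I 𝓘(ℝ, ℝ) f x :=
    eventually_mdifferentiableAt hf
  have h1 : ∀ᶠ x in 𝓝 z, f x • α x = pullbackVec I (fun x => (f x, F x)) β x := by
    filter_upwards [hα, hmd, hmf] with x h1 h2 h3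
    rw [h1, pullbackVec, pullbackVec, mvfderiv_prodMk h3 h2]
    rfl
  rw [mExtDeriv_eq_pullbackVec h1 (hf.prodMk_space hF) β.differentiableAt, hα.self_of_nhds]
  have h2 : extDeriv β (f z, F z) = wedgeOne (ContinuousLinearMap.fst ℝ ℝ G) C' := by
    ext v
    rw [extDeriv, β.fderiv, ContinuousAlternatingMap.alternatizeUncurryFin_apply, wedgeOne_apply]
    simp [β]
  rw [pullbackVec, h2, wedgeOne_comp, mvfderiv_prodMk hmf.self_of_nhds hmd.self_of_nhds]
  rfl

end LocalPullback

/-! ### The canonical forms on `E × E*` -/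

section Canonical

variable (E : Type*) [NormedAddCommGroup E] [NormedSpace ℝ E]

/-- The canonical one-form `(Y, P) ↦ p(Y)` at `(y, p)` on `E × E*`. -/
noncomputable def canonicalOneForm : (E × (E →L[ℝ] ℝ)) →L[ℝ] (E × (E →L[ℝ] ℝ)) [⋀^Fin 1]→L[ℝ] ℝ :=
  ((ContinuousAlternatingMap.ofSubsingletonLIE (𝕜 := ℝ) (E := E × (E →L[ℝ] ℝ)) (F := ℝ)
      (0 : Fin 1)).toContinuousLinearEquiv : _ →L[ℝ] _) ∘L
    ((ContinuousLinearMap.compL ℝ (E × (E →L[ℝ] ℝ)) E ℝ).flip (ContinuousLinearMap.fst ℝ _ _)) ∘L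
    ContinuousLinearMap.snd ℝ E (E →L[ℝ] ℝ)

/-- The canonical symplectic form on `E × E*`. -/
noncomputable def canonicalTwoForm : (E × (E →L[ℝ] ℝ)) [⋀^Fin 2]→L[ℝ] ℝ :=
  ContinuousAlternatingMap.alternatizeUncurryFin (canonicalOneForm E)

variable {E}

theorem canonicalOneForm_apply (a : E × (E →L[ℝ] ℝ)) (v : Fin 1 → E × (E →L[ℝ] ℝ)) :
    canonicalOneForm E a v = a.2 (v 0).1 := rfl

theorem canonicalTwoForm_apply (a b : E × (E →L[ℝ] ℝ)) :
    canonicalTwoForm E ![a, b] = a.2 b.1 - b.2 a.1 := by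
  rw [canonicalTwoForm, ContinuousAlternatingMap.alternatizeUncurryFin_apply, Fin.sum_univ_two]
  simp [canonicalOneForm_apply, Fin.removeNth]
  ring

/-- The one-form depends linearly on the point, so its derivative is constant and equal to itself.
-/
theorem extDeriv_canonicalOneForm (a : E × (E →L[ℝ] ℝ)) :
    extDeriv (canonicalOneForm E) a = canonicalTwoForm E := by
  rw [extDeriv, ContinuousLinearMap.fderiv, canonicalTwoForm]

/-- Testing against `(Y, 0)` kills the covector part; testing against `(0, f)` kills the vector
part, because functionals separate points. -/
theorem eq_zero_of_canonicalTwoForm {a : E × (E →L[ℝ] ℝ)}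
    (h : ∀ b, canonicalTwoForm E ![a, b] = 0) : a = 0 := by
  have h2 : a.2 = 0 := by
    ext Y
    simpa [canonicalTwoForm_apply] using h (Y, 0)
  have h1 : a.1 = 0 := by
    by_contra h0
    obtain ⟨f, hf⟩ := SeparatingDual.exists_ne_zero (R := ℝ) h0
    refine hf ?_
    simpa [canonicalTwoForm_apply] using h (0, f)
  exact Prod.ext h1 h2

end Canonical

/-! ### The Legendre transform and the symplectic form as a pull-back -/

section Legendre

open scoped Topology

variable {d : ℕ} {M : Type*} [TopologicalSpace M]
  [ChartedSpace (EuclideanSpace ℝ (Fin (d + 1))) M] [IsManifold (𝓡 (d + 1)) ∞ M]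

/-- The canonical momentum `g(p, ·) + q A`. -/
noncomputable def momentum (g : LorentzianMetric d M) (A : Potential d M) (q : ℝ)
    (z : TangentBundle (𝓡 (d + 1)) M) : TangentSpace (𝓡 (d + 1)) z.proj →L[ℝ] ℝ :=
  g.val z.proj z.snd + q • A.val z.proj

/-- The coordinates `(x, g(p, ·) + q A)` of the Legendre transform of a point of the tangent bundle,
in the chart of `M` at `x₀`. -/
noncomputable def legendre (g : LorentzianMetric d M) (A : Potential d M) (q : ℝ) (x₀ : M)
    (z : TangentBundle (𝓡 (d + 1)) M) :
    EuclideanSpace ℝ (Fin (d + 1)) × (EuclideanSpace ℝ (Fin (d + 1)) →L[ℝ] ℝ) :=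
  (extChartAt (𝓡 (d + 1)) x₀ z.proj, (momentum g A q z).comp
    ((trivializationAt (EuclideanSpace ℝ (Fin (d + 1))) (TangentSpace (𝓡 (d + 1))) x₀).symmL ℝ
      z.proj))

/-- The trivialization of the cotangent bundle at `x₀` is composition with the inverse of the
tangent trivialization, so smoothness of a section along `b` is smoothness of this expression. -/
theorem contMDiffAt_covector {N : Type*} [TopologicalSpace N] {E' H' : Type*}
    [NormedAddCommGroup E'] [NormedSpace ℝ E'] [TopologicalSpace H'] {I' : ModelWithCorners ℝ E' H'}
    [ChartedSpace H' N] {b : N → M} {z : N} {x₀ : M}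
    {α : Π z, TangentSpace (𝓡 (d + 1)) (b z) →L[ℝ] ℝ}
    (h : ContMDiffAt I' ((𝓡 (d + 1)).prod 𝓘(ℝ, EuclideanSpace ℝ (Fin (d + 1)) →L[ℝ] ℝ)) ∞
      (fun z => TotalSpace.mk' (EuclideanSpace ℝ (Fin (d + 1)) →L[ℝ] ℝ)
        (E := fun x : M => TangentSpace (𝓡 (d + 1)) x →L[ℝ] ℝ) (b z) (α z)) z)
    (hz : b z ∈ (chartAt (EuclideanSpace ℝ (Fin (d + 1))) x₀).source) :
    ContMDiffAt I' 𝓘(ℝ, EuclideanSpace ℝ (Fin (d + 1)) →L[ℝ] ℝ) ∞ (fun z => (α z).comp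
      ((trivializationAt (EuclideanSpace ℝ (Fin (d + 1))) (TangentSpace (𝓡 (d + 1))) x₀).symmL ℝ
        (b z))) z := by
  have := ((trivializationAt (EuclideanSpace ℝ (Fin (d + 1)) →L[ℝ] ℝ)
    (fun x : M => TangentSpace (𝓡 (d + 1)) x →L[ℝ] ℝ) x₀).contMDiffAt_iff (IB := 𝓡 (d + 1)) (n := ∞)
    (f := (fun z => TotalSpace.mk' (EuclideanSpace ℝ (Fin (d + 1)) →L[ℝ] ℝ)
        (E := fun x : M => TangentSpace (𝓡 (d + 1)) x →L[ℝ] ℝ) (b z) (α z))) (x₀ := z) ?_).1 h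
  · refine this.2.congr_of_eventuallyEq (Filter.Eventually.of_forall fun x => ?_)
    simp [hom_trivializationAt_apply, ContinuousLinearMap.inCoordinates]
  · rw [Trivialization.mem_source]
    simpa [hom_trivializationAt_baseSet] using hz

theorem contMDiffAt_const_smul {N : Type*} [TopologicalSpace N] {E' H' : Type*}
    [NormedAddCommGroup E'] [NormedSpace ℝ E'] [TopologicalSpace H'] {I' : ModelWithCorners ℝ E' H'}
    [ChartedSpace H' N] {G : Type*} [NormedAddCommGroup G] [NormedSpace ℝ G] {f : N → G} {z : N}
    (hf : ContMDiffAt I' 𝓘(ℝ, G) ∞ f z) (c : ℝ) :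
    ContMDiffAt I' 𝓘(ℝ, G) ∞ (fun x => c • f x) z :=
  (contDiff_const_smul (F := G) c).contMDiff.contMDiffAt.comp z hf

theorem contMDiffAt_legendre (g : LorentzianMetric d M) (A : Potential d M) (q : ℝ) {x₀ : M}
    {z : TangentBundle (𝓡 (d + 1)) M}
    (hz : z.proj ∈ (chartAt (EuclideanSpace ℝ (Fin (d + 1))) x₀).source) :
    ContMDiffAt (𝓡 (d + 1)).tangent 𝓘(ℝ, EuclideanSpace ℝ (Fin (d + 1)) ×
      (EuclideanSpace ℝ (Fin (d + 1)) →L[ℝ] ℝ)) ∞ (legendre g A q x₀) z := by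
  have h1 : ContMDiffAt (𝓡 (d + 1)).tangent 𝓘(ℝ, EuclideanSpace ℝ (Fin (d + 1))) ∞
      (fun z : TangentBundle (𝓡 (d + 1)) M => extChartAt (𝓡 (d + 1)) x₀ z.proj) z :=
    (contMDiffAt_extChartAt' hz).comp z (contMDiff_proj _ z)
  have h2 := contMDiffAt_covector (b := fun z : TangentBundle (𝓡 (d + 1)) M => z.proj)
    (α := fun z => g.val z.proj z.snd) (I' := (𝓡 (d + 1)).tangent)
    (ContMDiffAt.clm_bundle_apply (F₁ := EuclideanSpace ℝ (Fin (d + 1)))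
      (F₂ := EuclideanSpace ℝ (Fin (d + 1)) →L[ℝ] ℝ)
      (E₂ := fun x : M => TangentSpace (𝓡 (d + 1)) x →L[ℝ] ℝ)
      (g.contMDiff.comp (contMDiff_proj _)).contMDiffAt contMDiff_id.contMDiffAt) hz
  have h3 := contMDiffAt_covector (b := fun z : TangentBundle (𝓡 (d + 1)) M => z.proj)
    (α := fun z => A.val z.proj) (I' := (𝓡 (d + 1)).tangent)
    (A.contMDiff.comp (contMDiff_proj _)).contMDiffAt hz
  refine h1.prodMk_space ((h2.add (contMDiffAt_const_smul h3 q)).congr_of_eventuallyEq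
    (Filter.Eventually.of_forall fun x => ?_))
  ext v
  simp [momentum]

theorem mvfderiv_legendre_fst (g : LorentzianMetric d M) (A : Potential d M) (q : ℝ) {x₀ : M}
    {z : TangentBundle (𝓡 (d + 1)) M}
    (hz : z.proj ∈ (chartAt (EuclideanSpace ℝ (Fin (d + 1))) x₀).source)
    (X : TangentSpace (𝓡 (d + 1)).tangent z) :
    (mvfderiv (𝓡 (d + 1)).tangent (legendre g A q x₀) z X).1 =
      mfderiv (𝓡 (d + 1)) 𝓘(ℝ, EuclideanSpace ℝ (Fin (d + 1))) (extChartAt (𝓡 (d + 1)) x₀) z.proj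
        (mfderiv (𝓡 (d + 1)).tangent (𝓡 (d + 1))
          (TotalSpace.proj : TangentBundle (𝓡 (d + 1)) M → M) z X) := by
  have h1 : MDifferentiableAt (𝓡 (d + 1)).tangent 𝓘(ℝ, EuclideanSpace ℝ (Fin (d + 1)) ×
      (EuclideanSpace ℝ (Fin (d + 1)) →L[ℝ] ℝ)) (legendre g A q x₀) z :=
    (contMDiffAt_legendre g A q hz).mdifferentiableAt (by simp)
  have h2 : MDifferentiableAt (𝓡 (d + 1)).tangent (𝓡 (d + 1))
      (TotalSpace.proj : TangentBundle (𝓡 (d + 1)) M → M) z :=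
    (contMDiff_proj (n := ∞) _ z).mdifferentiableAt (by simp)
  have h3 : MDifferentiableAt (𝓡 (d + 1)) 𝓘(ℝ, EuclideanSpace ℝ (Fin (d + 1)))
      (extChartAt (𝓡 (d + 1)) x₀) z.proj :=
    (contMDiffAt_extChartAt' (n := ∞) hz).mdifferentiableAt (by simp)
  have h4 := mfderiv_comp z h3 h2
  have h5 := mvfderiv_clm_comp h1 (ContinuousLinearMap.fst ℝ (EuclideanSpace ℝ (Fin (d + 1)))
      (EuclideanSpace ℝ (Fin (d + 1)) →L[ℝ] ℝ)) X
  exact h5.symm.trans (congrArg (fun T => T X) h4)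

/-- Over the chart domain the tangent trivialization is the differential of the chart, which `symmL`
inverts. -/
theorem momentum_comp_symmL (g : LorentzianMetric d M) (A : Potential d M) (q : ℝ) {x₀ : M}
    {z : TangentBundle (𝓡 (d + 1)) M}
    (hz : z.proj ∈ (chartAt (EuclideanSpace ℝ (Fin (d + 1))) x₀).source)
    (Y : TangentSpace (𝓡 (d + 1)) z.proj) :
    (legendre g A q x₀ z).2 (mfderiv (𝓡 (d + 1)) 𝓘(ℝ, EuclideanSpace ℝ (Fin (d + 1)))
      (extChartAt (𝓡 (d + 1)) x₀) z.proj Y) = momentum g A q z Y := by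
  have : IsManifold (𝓡 (d + 1)) 1 M := IsManifold.of_le (n := ∞) (by simp)
  have h := (trivializationAt (EuclideanSpace ℝ (Fin (d + 1)))
    (TangentSpace (𝓡 (d + 1)) : M → Type _) x₀).symmL_continuousLinearMapAt (R := ℝ)
    (b := z.proj) (by simpa using hz) Y
  rw [TangentBundle.continuousLinearMapAt_trivializationAt hz] at h
  exact congrArg (momentum g A q z) h

theorem poincareForm_eq_pullbackVec (g : LorentzianMetric d M) (A : Potential d M) (q : ℝ) {x₀ : M}
    {z : TangentBundle (𝓡 (d + 1)) M}
    (hz : z.proj ∈ (chartAt (EuclideanSpace ℝ (Fin (d + 1))) x₀).source) :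
    poincareForm g A q z = pullbackVec (𝓡 (d + 1)).tangent (legendre g A q x₀)
      (canonicalOneForm (EuclideanSpace ℝ (Fin (d + 1)))) z := by
  ext v
  change momentum g A q z (mfderiv (𝓡 (d + 1)).tangent (𝓡 (d + 1))
          (TotalSpace.proj : TangentBundle (𝓡 (d + 1)) M → M) z (v 0)) =
    (legendre g A q x₀ z).2 (mvfderiv (𝓡 (d + 1)).tangent (legendre g A q x₀) z (v 0)).1
  rw [mvfderiv_legendre_fst g A q hz, momentum_comp_symmL g A q hz]

/-- Exterior derivative commutes with pull-back, so the metric and the potential enter `Ω_s` only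
through the Legendre map; the model form is constant. -/
theorem symplecticForm_eq_pullbackVec (g : LorentzianMetric d M) (A : Potential d M) (q : ℝ)
    {x₀ : M} {z : TangentBundle (𝓡 (d + 1)) M}
    (hz : z.proj ∈ (chartAt (EuclideanSpace ℝ (Fin (d + 1))) x₀).source) :
    symplecticForm g A q z = pullbackVec (𝓡 (d + 1)).tangent (legendre g A q x₀)
      (fun _ => canonicalTwoForm (EuclideanSpace ℝ (Fin (d + 1)))) z := by
  have h1 : ∀ᶠ w in 𝓝 z, poincareForm g A q w = pullbackVec (𝓡 (d + 1)).tangent (legendre g A q x₀)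
      (canonicalOneForm (EuclideanSpace ℝ (Fin (d + 1)))) w := by
    filter_upwards [((chartAt (EuclideanSpace ℝ (Fin (d + 1))) x₀).open_source.preimage
      (FiberBundle.continuous_proj _ _)).mem_nhds hz] with w hw
      using poincareForm_eq_pullbackVec g A q hw
  rw [symplecticForm, mExtDeriv_eq_pullbackVec h1 (contMDiffAt_legendre g A q hz)
    (ContinuousLinearMap.differentiableAt _)]
  congr 1
  funext a
  exact extDeriv_canonicalOneForm a

/-- The inclusion of the tangent space at `x` into the tangent bundle. -/
def fiberIncl (x : M) (w : EuclideanSpace ℝ (Fin (d + 1))) : TangentBundle (𝓡 (d + 1)) M := ⟨x, w⟩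

end Legendre

/-! ### Vertical vectors and derivatives along the fibres -/

section Vertical

open scoped Topology

variable {d : ℕ} {M : Type*} [TopologicalSpace M]
  [ChartedSpace (EuclideanSpace ℝ (Fin (d + 1))) M] [IsManifold (𝓡 (d + 1)) ∞ M]

theorem trivializationAt_fiberIncl (x : M) (w : EuclideanSpace ℝ (Fin (d + 1))) :
    (trivializationAt (EuclideanSpace ℝ (Fin (d + 1))) (TangentSpace (𝓡 (d + 1)) : M → Type _) x
        (fiberIncl (d := d) x w)).2 = w :=
  tangentCoordChange_self (I := 𝓡 (d + 1)) (mem_extChartAt_source x)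

theorem contMDiff_fiberIncl (x : M) : ContMDiff 𝓘(ℝ, EuclideanSpace ℝ (Fin (d + 1)))
    (𝓡 (d + 1)).tangent ∞ (fiberIncl (d := d) x) := by
  intro w
  rw [contMDiffAt_totalSpace]
  refine ⟨contMDiffAt_const, ?_⟩
  exact contMDiffAt_id.congr_of_eventuallyEq
    (Filter.Eventually.of_forall fun w => trivializationAt_fiberIncl x w)

theorem mdifferentiableAt_fiberIncl (x : M) (w : EuclideanSpace ℝ (Fin (d + 1))) :
    MDifferentiableAt 𝓘(ℝ, EuclideanSpace ℝ (Fin (d + 1)))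
    (𝓡 (d + 1)).tangent (fiberIncl (d := d) x) w :=
  (contMDiff_fiberIncl x w).mdifferentiableAt (by simp)

/-- The vertical lift of tangent vectors. -/
noncomputable def verticalLift (z : TangentBundle (𝓡 (d + 1)) M) :
    EuclideanSpace ℝ (Fin (d + 1)) →L[ℝ] TangentSpace (𝓡 (d + 1)).tangent z :=
  mfderiv 𝓘(ℝ, EuclideanSpace ℝ (Fin (d + 1))) (𝓡 (d + 1)).tangent (fiberIncl (d := d) z.proj) z.snd

/-- Differentiation along a vertical vector is ordinary differentiation on the fibre, a fixed vector
space. -/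
theorem mvfderiv_verticalLift {G : Type*} [NormedAddCommGroup G] [NormedSpace ℝ G]
    {z : TangentBundle (𝓡 (d + 1)) M} {F : TangentBundle (𝓡 (d + 1)) M → G}
    (hF : MDifferentiableAt (𝓡 (d + 1)).tangent 𝓘(ℝ, G) F z)
    {D : EuclideanSpace ℝ (Fin (d + 1)) →L[ℝ] G}
    (hD : HasFDerivAt (fun w => F (fiberIncl z.proj w)) D z.snd)
    (V : EuclideanSpace ℝ (Fin (d + 1))) :
    mvfderiv (𝓡 (d + 1)).tangent F z (verticalLift z V) = D V := by
  have h := mfderiv_comp (I' := (𝓡 (d + 1)).tangent) (I'' := 𝓘(ℝ, G))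
    (f := fiberIncl z.proj) (g := F) (z.snd : EuclideanSpace ℝ (Fin (d + 1))) hF (mdifferentiableAt_fiberIncl z.proj z.snd)
  have h2 := hD.hasMFDerivAt.mfderiv
  have h3 : (F ∘ fiberIncl z.proj) = fun w => F (fiberIncl z.proj w) := rfl
  rw [h3, h2] at h
  exact (congrArg (fun T => T V) h).symm

theorem extChartAt_fiberIncl (z : TangentBundle (𝓡 (d + 1)) M)
    (w : EuclideanSpace ℝ (Fin (d + 1))) :
    extChartAt (𝓡 (d + 1)).tangent z (fiberIncl z.proj w) =
      (extChartAt (𝓡 (d + 1)) z.proj z.proj, w) := by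
  rw [FiberBundle.extChartAt]
  exact Prod.ext rfl (trivializationAt_fiberIncl z.proj w)

/-- In the bundle chart at `z` the first component of `X` is the image of `π_* X`, which is zero,
and the lift of `V` has components `(0, V)`. -/
theorem exists_verticalLift {z : TangentBundle (𝓡 (d + 1)) M}
    {X : TangentSpace (𝓡 (d + 1)).tangent z}
    (hX : mfderiv (𝓡 (d + 1)).tangent (𝓡 (d + 1))
      (TotalSpace.proj : TangentBundle (𝓡 (d + 1)) M → M) z X = 0) :
    ∃ V, X = verticalLift z V := by
  have hc : MDifferentiableAt (𝓡 (d + 1)).tangent 𝓘(ℝ, EuclideanSpace ℝ (Fin (d + 1)) ×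
      EuclideanSpace ℝ (Fin (d + 1))) (extChartAt (𝓡 (d + 1)).tangent z) z :=
    (contMDiffAt_extChartAt (n := ∞)).mdifferentiableAt (by simp)
  have hinj : Function.Injective (mvfderiv (𝓡 (d + 1)).tangent
      (extChartAt (𝓡 (d + 1)).tangent z) z) :=
    (isInvertible_mfderiv_extChartAt (mem_extChartAt_source z)).injective
  refine ⟨(mvfderiv (𝓡 (d + 1)).tangent (extChartAt (𝓡 (d + 1)).tangent z) z X).2, hinj ?_⟩
  have hD : HasFDerivAt (fun w => extChartAt (𝓡 (d + 1)).tangent z (fiberIncl z.proj w))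
      (ContinuousLinearMap.inr ℝ (EuclideanSpace ℝ (Fin (d + 1))) (EuclideanSpace ℝ (Fin (d + 1))))
      z.snd := by
    simp only [extChartAt_fiberIncl]
    exact (hasFDerivAt_const _ _).prodMk (hasFDerivAt_id _)
  rw [mvfderiv_verticalLift hc hD]
  refine Prod.ext ?_ rfl
  have h1 : MDifferentiableAt (𝓡 (d + 1)) 𝓘(ℝ, EuclideanSpace ℝ (Fin (d + 1)))
      (extChartAt (𝓡 (d + 1)) z.proj) z.proj :=
    (contMDiffAt_extChartAt (n := ∞)).mdifferentiableAt (by simp)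
  have h2 : MDifferentiableAt (𝓡 (d + 1)).tangent (𝓡 (d + 1))
      (TotalSpace.proj : TangentBundle (𝓡 (d + 1)) M → M) z :=
    (contMDiff_proj (n := ∞) _ z).mdifferentiableAt (by simp)
  have h3 := mvfderiv_clm_comp hc (ContinuousLinearMap.fst ℝ (EuclideanSpace ℝ (Fin (d + 1)))
    (EuclideanSpace ℝ (Fin (d + 1)))) X
  have h4 := congrArg (fun T => T X) (mfderiv_comp z h1 h2)
  refine h3.symm.trans (h4.trans ?_)
  rw [ContinuousLinearMap.comp_apply, hX, map_zero]
  rfl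

theorem symmL_self (x : M) (Y : EuclideanSpace ℝ (Fin (d + 1))) :
    (trivializationAt (EuclideanSpace ℝ (Fin (d + 1)))
      (TangentSpace (𝓡 (d + 1)) : M → Type _) x).symmL ℝ x Y = Y := by
  have : IsManifold (𝓡 (d + 1)) 1 M := IsManifold.of_le (n := ∞) (by simp)
  rw [TangentBundle.symmL_trivializationAt_eq_core (mem_chart_source _ x)]
  exact tangentCoordChange_self (I := 𝓡 (d + 1)) (mem_extChartAt_source x)

/-- On a fibre the Legendre map is affine in `p`; the potential only contributes a constant. -/
theorem mvfderiv_legendre_verticalLift (g : LorentzianMetric d M) (A : Potential d M) (q : ℝ)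
    (z : TangentBundle (𝓡 (d + 1)) M) (V : EuclideanSpace ℝ (Fin (d + 1))) :
    mvfderiv (𝓡 (d + 1)).tangent (legendre g A q z.proj) z (verticalLift z V) =
      (0, g.val z.proj V) := by
  let K : EuclideanSpace ℝ (Fin (d + 1)) →L[ℝ] EuclideanSpace ℝ (Fin (d + 1)) →L[ℝ] ℝ :=
    g.val z.proj
  let a : EuclideanSpace ℝ (Fin (d + 1)) →L[ℝ] ℝ := A.val z.proj
  have h : (fun w => legendre g A q z.proj (fiberIncl z.proj w)) =
      fun w => (extChartAt (𝓡 (d + 1)) z.proj z.proj, K w + q • a) := by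
    funext w
    refine Prod.ext rfl (ContinuousLinearMap.ext fun Y => ?_)
    exact congrArg (momentum g A q (fiberIncl z.proj w)) (symmL_self z.proj Y)
  have hD : HasFDerivAt (fun w => legendre g A q z.proj (fiberIncl z.proj w))
      ((0 : _ →L[ℝ] EuclideanSpace ℝ (Fin (d + 1))).prod K) z.snd := by
    rw [h]
    exact (hasFDerivAt_const _ _).prodMk (K.hasFDerivAt.add_const _)
  exact mvfderiv_verticalLift
    ((contMDiffAt_legendre g A q (mem_chart_source _ _)).mdifferentiableAt (by simp)) hD V

theorem dHamiltonian_verticalLift (g : LorentzianMetric d M)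
    (z : TangentBundle (𝓡 (d + 1)) M) (V : EuclideanSpace ℝ (Fin (d + 1))) :
    dHamiltonian g z (verticalLift z V) = g.val z.proj z.snd V := by
  let K : EuclideanSpace ℝ (Fin (d + 1)) →L[ℝ] EuclideanSpace ℝ (Fin (d + 1)) →L[ℝ] ℝ :=
    g.val z.proj
  let v : EuclideanSpace ℝ (Fin (d + 1)) := z.snd
  have hD : HasFDerivAt (fun w => K w w / 2) (K v) v := by
    have h1 := (K.hasFDerivAt (x := v)).clm_apply (hasFDerivAt_id v)
    simp only [div_eq_mul_inv]
    refine (h1.mul_const (2⁻¹ : ℝ)).congr_fderiv ?_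
    ext W
    have : K W v = K v W := g.symm z.proj W v
    simp [this]
    ring
  exact mvfderiv_verticalLift
    ((contMDiff_hamiltonian g).contMDiffAt.mdifferentiableAt (by simp)) hD V

/-- Pairing with a vector of the orthonormal basis returns the corresponding coefficient up to sign.
-/
theorem LorentzianMetric.eq_zero_of_forall (g : LorentzianMetric d M) {x : M}
    {V : TangentSpace (𝓡 (d + 1)) x} (h : ∀ W, g.val x V W = 0) : V = 0 := by
  obtain ⟨b, hb⟩ := g.signature x
  rw [← b.sum_repr V]
  refine Finset.sum_eq_zero fun j _ => ?_
  have h1 := h (b j)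
  rw [← b.sum_repr V, map_sum] at h1
  simp only [map_smul, sum_apply, smul_apply, hb] at h1
  rw [Finset.sum_eq_single j (fun i _ hij => by simp [hij]) (by simp)] at h1
  have h2 : b.repr V j = 0 := by
    rcases eq_or_ne j 0 with rfl | hj <;> simpa [*] using h1
  rw [h2, zero_smul]

end Vertical

/-! ### Non-degeneracy, the Liouville field and the transverse factor -/

section Symplectic

open scoped Topology

variable {d : ℕ} {M : Type*} [TopologicalSpace M]
  [ChartedSpace (EuclideanSpace ℝ (Fin (d + 1))) M] [IsManifold (𝓡 (d + 1)) ∞ M]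

instance finiteDimensional_tangentSpace (z : TangentBundle (𝓡 (d + 1)) M) :
    FiniteDimensional ℝ (TangentSpace (𝓡 (d + 1)).tangent z) :=
  inferInstanceAs (FiniteDimensional ℝ
    (EuclideanSpace ℝ (Fin (d + 1)) × EuclideanSpace ℝ (Fin (d + 1))))

theorem finrank_tangentSpace (z : TangentBundle (𝓡 (d + 1)) M) :
    Module.finrank ℝ (TangentSpace (𝓡 (d + 1)).tangent z) = 2 * d + 2 := by
  change Module.finrank ℝ (EuclideanSpace ℝ (Fin (d + 1)) × EuclideanSpace ℝ (Fin (d + 1))) = _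
  rw [Module.finrank_prod, finrank_euclideanSpace_fin]
  ring

/-- A vector in the kernel projects to zero, hence is the lift of some `V`; then `g(V, ·) = 0`
forces `V = 0`. -/
theorem injective_mvfderiv_legendre (g : LorentzianMetric d M) (A : Potential d M) (q : ℝ)
    (z : TangentBundle (𝓡 (d + 1)) M) :
    Function.Injective (mvfderiv (𝓡 (d + 1)).tangent (legendre g A q z.proj) z) := by
  rw [injective_iff_map_eq_zero]
  intro X hX
  have h1 := mvfderiv_legendre_fst g A q (mem_chart_source _ z.proj) X
  rw [hX] at h1
  have h2 : mfderiv (𝓡 (d + 1)).tangent (𝓡 (d + 1))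
      (TotalSpace.proj : TangentBundle (𝓡 (d + 1)) M → M) z X = 0 :=
    (isInvertible_mfderiv_extChartAt (mem_extChartAt_source z.proj)).injective
      (h1.symm.trans (map_zero _).symm)
  obtain ⟨V, rfl⟩ := exists_verticalLift h2
  rw [mvfderiv_legendre_verticalLift] at hX
  have h3 : V = 0 := g.eq_zero_of_forall fun W => congrArg (fun T => T W) (congrArg Prod.snd hX)
  rw [h3, map_zero]

theorem surjective_mvfderiv_legendre (g : LorentzianMetric d M) (A : Potential d M) (q : ℝ)
    (z : TangentBundle (𝓡 (d + 1)) M) :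
    Function.Surjective (mvfderiv (𝓡 (d + 1)).tangent (legendre g A q z.proj) z) := by
  refine (LinearMap.injective_iff_surjective_of_finrank_eq_finrank (f :=
    (mvfderiv (𝓡 (d + 1)).tangent (legendre g A q z.proj) z).toLinearMap) ?_).1
    (injective_mvfderiv_legendre g A q z)
  rw [finrank_tangentSpace, Module.finrank_prod, finrank_euclideanSpace_fin,
    ← LinearMap.toContinuousLinearMap.finrank_eq, Module.finrank_linearMap,
    finrank_euclideanSpace_fin, Module.finrank_self]
  ring

theorem symplecticForm_apply (g : LorentzianMetric d M) (A : Potential d M) (q : ℝ)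
    (z : TangentBundle (𝓡 (d + 1)) M) (X Y : TangentSpace (𝓡 (d + 1)).tangent z) :
    symplecticForm g A q z ![X, Y] = canonicalTwoForm (EuclideanSpace ℝ (Fin (d + 1)))
      ![mvfderiv (𝓡 (d + 1)).tangent (legendre g A q z.proj) z X,
        mvfderiv (𝓡 (d + 1)).tangent (legendre g A q z.proj) z Y] := by
  rw [symplecticForm_eq_pullbackVec g A q (mem_chart_source _ z.proj), pullbackVec,
    ContinuousAlternatingMap.compContinuousLinearMap_apply]
  congr 1
  funext i
  fin_cases i <;> rfl

/-- The symplectic form is non-degenerate. -/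
theorem eq_zero_of_symplecticForm (g : LorentzianMetric d M) (A : Potential d M) (q : ℝ)
    {z : TangentBundle (𝓡 (d + 1)) M} {X : TangentSpace (𝓡 (d + 1)).tangent z}
    (hX : ∀ Y, symplecticForm g A q z ![X, Y] = 0) : X = 0 := by
  refine injective_mvfderiv_legendre g A q z ((eq_zero_of_canonicalTwoForm fun b => ?_).trans
    (map_zero _).symm)
  obtain ⟨Y, rfl⟩ := surjective_mvfderiv_legendre g A q z b
  rw [← symplecticForm_apply, hX]

theorem exists_symplecticForm_eq (g : LorentzianMetric d M) (A : Potential d M) (q : ℝ)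
    {z : TangentBundle (𝓡 (d + 1)) M} (a : TangentSpace (𝓡 (d + 1)).tangent z →L[ℝ] ℝ) :
    ∃ X, ∀ Y, symplecticForm g A q z ![X, Y] = a Y := by
  have h := (LinearMap.injective_iff_surjective_of_finrank_eq_finrank
    (f := twoFormBilin (symplecticForm g A q z)) (by
      rw [Module.finrank_linearMap, Module.finrank_self, mul_one])).1 (by
      rw [injective_iff_map_eq_zero]
      exact fun X hX => eq_zero_of_symplecticForm g A q fun Y => congrArg (fun T => T Y) hX)
  obtain ⟨X, hX⟩ := h a
  exact ⟨X, fun Y => congrArg (fun T => T Y) hX⟩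

/-- Non-degeneracy in finite dimension makes `X ↦ Ω_s(X, ·)` onto, so the choice defining `L` does
satisfy its equation. The sign comes from moving `L` to the first slot. -/
theorem symplecticForm_liouvilleField (g : LorentzianMetric d M) (A : Potential d M) (q : ℝ)
    (z : TangentBundle (𝓡 (d + 1)) M) (u : TangentSpace (𝓡 (d + 1)).tangent z) :
    symplecticForm g A q z ![liouvilleField g A q z, u] = - dHamiltonian g z u := by
  have h : ∃ v, ∀ u, dHamiltonian g z u = symplecticForm g A q z ![u, v] := by
    obtain ⟨X, hX⟩ := exists_symplecticForm_eq g A q (- dHamiltonian g z)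
    refine ⟨X, fun u => ?_⟩
    rw [twoForm_swap, hX]
    simp
  rw [twoForm_swap]
  exact congrArg Neg.neg (Classical.epsilon_spec h u).symm

theorem dHamiltonian_liouvilleField (g : LorentzianMetric d M) (A : Potential d M) (q : ℝ)
    (z : TangentBundle (𝓡 (d + 1)) M) : dHamiltonian g z (liouvilleField g A q z) = 0 := by
  have h1 := symplecticForm_liouvilleField g A q z (liouvilleField g A q z)
  have h2 := twoForm_swap (symplecticForm g A q z) (liouvilleField g A q z) (liouvilleField g A q z)
  linarith

/-- The one-form `X ↦ g_x(p, π_* X)`. -/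
noncomputable def kineticForm (g : LorentzianMetric d M) (z : TangentBundle (𝓡 (d + 1)) M) :
    TangentSpace (𝓡 (d + 1)).tangent z →L[ℝ] ℝ :=
  (g.val z.proj z.snd).comp (mfderiv (𝓡 (d + 1)).tangent (𝓡 (d + 1))
    (TotalSpace.proj : TangentBundle (𝓡 (d + 1)) M → M) z)

/-- Charge `0` removes the potential from the momentum, leaving `g(p, ·)`. -/
theorem kineticForm_apply (g : LorentzianMetric d M) (A : Potential d M) {x₀ : M}
    {z : TangentBundle (𝓡 (d + 1)) M}
    (hz : z.proj ∈ (chartAt (EuclideanSpace ℝ (Fin (d + 1))) x₀).source)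
    (X : TangentSpace (𝓡 (d + 1)).tangent z) :
    kineticForm g z X = (legendre g A 0 x₀ z).2
      (mvfderiv (𝓡 (d + 1)).tangent (legendre g A 0 x₀) z X).1 := by
  rw [mvfderiv_legendre_fst g A 0 hz, momentum_comp_symmL g A 0 hz]
  simp [momentum, kineticForm]

/-- The Euler vector field `p ∂_p`, the vertical lift of `p` at `(x, p)`. -/
noncomputable def eulerField (z : TangentBundle (𝓡 (d + 1)) M) :
    TangentSpace (𝓡 (d + 1)).tangent z :=
  verticalLift z z.snd

theorem mvfderiv_legendre_eulerField (g : LorentzianMetric d M) (A : Potential d M) (q : ℝ)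
    (z : TangentBundle (𝓡 (d + 1)) M) :
    mvfderiv (𝓡 (d + 1)).tangent (legendre g A q z.proj) z (eulerField z) =
      (0, (legendre g A 0 z.proj z).2) := by
  refine (mvfderiv_legendre_verticalLift g A q z z.snd).trans (Prod.ext rfl ?_)
  refine ContinuousLinearMap.ext fun Y => ?_
  refine Eq.trans ?_ (congrArg (momentum g A 0 z) (symmL_self z.proj Y)).symm
  simp [momentum]

theorem symplecticForm_eulerField (g : LorentzianMetric d M) (A : Potential d M) (q : ℝ)
    (z : TangentBundle (𝓡 (d + 1)) M) (X : TangentSpace (𝓡 (d + 1)).tangent z) :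
    symplecticForm g A q z ![eulerField z, X] = kineticForm g z X := by
  rw [symplecticForm_apply, mvfderiv_legendre_eulerField, canonicalTwoForm_apply,
    kineticForm_apply g A (mem_chart_source _ z.proj), map_zero, sub_zero,
    mvfderiv_legendre_fst g A _ (mem_chart_source _ z.proj),
    mvfderiv_legendre_fst g A _ (mem_chart_source _ z.proj)]

/-- Euler's relation: `H` is homogeneous of degree `2` in `p`. -/
theorem dHamiltonian_eulerField (g : LorentzianMetric d M)
    (z : TangentBundle (𝓡 (d + 1)) M) :
    dHamiltonian g z (eulerField z) = 2 * hamiltonian g z := by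
  refine (dHamiltonian_verticalLift g z z.snd).trans ?_
  rw [hamiltonian]
  ring

/-- The normalization constant of `tangentVolumeForm`. -/
noncomputable def volumeConst (d : ℕ) : ℝ :=
  (-1 : ℝ) ^ ((d + 1) * d / 2) / (Nat.factorial (d + 1) : ℝ)

/-- The form `(2H)⁻¹ i_U Λ`, where `U` is the vertical lift of `p`. -/
noncomputable def transverseFactor (g : LorentzianMetric d M) (A : Potential d M) (q : ℝ) :
    DiffForm (𝓡 (d + 1)).tangent (TangentBundle (𝓡 (d + 1)) M) (2 * d + 1) := fun z =>
  ((2 * hamiltonian g z)⁻¹ * (volumeConst d * (d + 1))) •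
    wedgeOne (kineticForm g z) (wedgePow (n := d) rfl (symplecticForm g A q z))

/-- The product of `dH` with the top power of `Ω_s` has degree `2d + 3` on a space of dimension `2d
+ 2`, so it vanishes; contract it with the Euler field and divide by `2H`. -/
theorem wedgeOne_transverseFactor (g : LorentzianMetric d M) (A : Potential d M) (q : ℝ)
    {z : TangentBundle (𝓡 (d + 1)) M} (hz : hamiltonian g z ≠ 0) :
    wedgeOne (dHamiltonian g z) (transverseFactor g A q z) = tangentVolumeForm g A q z := by
  have h1 := interiorProduct_wedgePow (n := d) rfl (by ring) (symplecticForm g A q z)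
    (eulerField z) (kineticForm g z)
    (fun u => (symplecticForm_eulerField g A q z u).symm)
  have h2 := interiorProduct_wedgeOne (dHamiltonian g z)
    (wedgePow (n := d + 1) (N := 2 * d + 1 + 1) (by ring) (symplecticForm g A q z))
    (eulerField z)
  rw [eq_zero_of_finrank_lt (by rw [finrank_tangentSpace]; omega)
    (wedgeOne (dHamiltonian g z) (wedgePow (n := d + 1) _ (symplecticForm g A q z))), h1,
    dHamiltonian_eulerField, wedgeOne_smul] at h2
  have h3 := (sub_eq_zero.1 h2.symm).symm
  rw [transverseFactor, wedgeOne_smul, mul_smul, mul_smul, h3, smul_comm (volumeConst d),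
    inv_smul_smul₀ (mul_ne_zero two_ne_zero hz)]
  rfl

theorem contDiffAt_smul_wedgeOne {G G' : Type*} [NormedAddCommGroup G] [NormedSpace ℝ G]
    [NormedAddCommGroup G'] [NormedSpace ℝ G'] {k : ℕ} {c : G' → ℝ} {a : G' → G →L[ℝ] ℝ} {x : G'}
    (hc : ContDiffAt ℝ ∞ c x) (ha : ContDiffAt ℝ ∞ a x) (C : G [⋀^Fin k]→L[ℝ] ℝ) :
    ContDiffAt ℝ ∞ (fun x => c x • wedgeOne (a x) C) x := by
  have h : (fun x => wedgeOne (a x) C) = fun x =>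
      ContinuousAlternatingMap.alternatizeUncurryFinCLM ℝ G ℝ ((a x).smulRight C) := by
    funext x
    ext v
    rw [wedgeOne_apply, ContinuousAlternatingMap.alternatizeUncurryFinCLM_apply,
      ContinuousAlternatingMap.alternatizeUncurryFin_apply]
    simp
  refine hc.smul ?_
  rw [h]
  exact (ContinuousLinearMap.contDiff _).contDiffAt.comp x (ha.smulRight contDiffAt_const)

/-- The form is a pull-back under `(H, legendre 0, legendre q)`: the first entry supplies the scalar
factor, the second the kinetic form, the third the power of `Ω_s`. The condition `H < 0` keeps
`(2H)⁻¹` smooth. -/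
theorem smoothFormOn_transverseFactor (g : LorentzianMetric d M) (A : Potential d M) (q : ℝ) :
    SmoothFormOn (transverseFactor g A q) {z | hamiltonian g z < 0} := by
  let P := EuclideanSpace ℝ (Fin (d + 1)) × (EuclideanSpace ℝ (Fin (d + 1)) →L[ℝ] ℝ)
  let C : (ℝ × P × P) [⋀^Fin (2 * d)]→L[ℝ] ℝ :=
    (wedgePow rfl (canonicalTwoForm (EuclideanSpace ℝ (Fin (d + 1))))).compContinuousLinearMap
      ((ContinuousLinearMap.snd ℝ P P).comp (ContinuousLinearMap.snd ℝ ℝ (P × P)))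
  let a : ℝ × P × P → (ℝ × P × P) →L[ℝ] ℝ := fun x => x.2.1.2.comp
    ((ContinuousLinearMap.fst ℝ _ _).comp
      ((ContinuousLinearMap.fst ℝ P P).comp (ContinuousLinearMap.snd ℝ ℝ (P × P))))
  have ha : ContDiff ℝ ∞ a := by
    refine ContDiff.clm_comp ?_ contDiff_const
    exact contDiff_snd.comp (contDiff_fst.comp contDiff_snd)
  refine smoothFormOn_of_pullbackVec fun z hz =>
    ⟨fun w => (hamiltonian g w, legendre g A 0 z.proj w, legendre g A q z.proj w),
      fun x => ((2 * x.1)⁻¹ * (volumeConst d * (d + 1))) • wedgeOne (a x) C, ?_, ?_, ?_⟩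
  · filter_upwards [((chartAt (EuclideanSpace ℝ (Fin (d + 1))) z.proj).open_source.preimage
      (FiberBundle.continuous_proj _ _)).mem_nhds (mem_chart_source _ z.proj)] with w hw
    have hL : ∀ q, MDifferentiableAt (𝓡 (d + 1)).tangent 𝓘(ℝ, P) (legendre g A q z.proj) w :=
      fun q => (contMDiffAt_legendre g A q hw).mdifferentiableAt (by simp)
    have hD := mvfderiv_prodMk ((contMDiff_hamiltonian g).contMDiffAt.mdifferentiableAt (by simp))
      ((hL 0).prodMk_space (hL q))
    have hD' := mvfderiv_prodMk (hL 0) (hL q)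
    rw [hD'] at hD
    change _ = (((2 * hamiltonian g w)⁻¹ * (volumeConst d * (d + 1))) •
      wedgeOne _ C).compContinuousLinearMap _
    rw [hD, transverseFactor, symplecticForm_eq_pullbackVec g A q hw, pullbackVec, ← wedgePow_comp]
    have hk : kineticForm g w = (a (hamiltonian g w, legendre g A 0 z.proj w,
        legendre g A q z.proj w)).comp ((mvfderiv (𝓡 (d + 1)).tangent (hamiltonian g) w).prod
        ((mvfderiv (𝓡 (d + 1)).tangent (legendre g A 0 z.proj) w).prod
          (mvfderiv (𝓡 (d + 1)).tangent (legendre g A q z.proj) w))) :=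
      ContinuousLinearMap.ext fun X => kineticForm_apply g A hw X
    have := wedgeOne_comp (a (hamiltonian g w, legendre g A 0 z.proj w,
        legendre g A q z.proj w)) C ((mvfderiv (𝓡 (d + 1)).tangent (hamiltonian g) w).prod
        ((mvfderiv (𝓡 (d + 1)).tangent (legendre g A 0 z.proj) w).prod
          (mvfderiv (𝓡 (d + 1)).tangent (legendre g A q z.proj) w)))
    rw [hk]
    exact congrArg (fun T => ((2 * hamiltonian g w)⁻¹ * (volumeConst d * (d + 1))) • T) this.symm
  · exact (contMDiff_hamiltonian g).contMDiffAt.prodMk_space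
      ((contMDiffAt_legendre g A 0 (mem_chart_source _ _)).prodMk_space
        (contMDiffAt_legendre g A q (mem_chart_source _ _)))
  · have hz0 : (2 : ℝ) * hamiltonian g z ≠ 0 := mul_ne_zero two_ne_zero (ne_of_lt hz)
    have h1 : ContDiffAt ℝ ∞ (fun x : ℝ × P × P => (2 * x.1)⁻¹)
        (hamiltonian g z, legendre g A 0 z.proj z, legendre g A q z.proj z) :=
      (contDiffAt_const.mul contDiffAt_fst).inv hz0
    exact contDiffAt_smul_wedgeOne (h1.mul contDiffAt_const) ha.contDiffAt C

theorem isTransverseFactor_transverseFactor (g : LorentzianMetric d M) (A : Potential d M) (q : ℝ) :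
    IsTransverseFactor g A q (transverseFactor g A q) :=
  ⟨smoothFormOn_transverseFactor g A q, fun _ hz => wedgeOne_transverseFactor g A q hz.ne⟩

end Symplectic

/-! ### The induced volume form and the Liouville field on the mass shell -/

section Shell

open scoped Topology

variable {d : ℕ} {M : Type*} [TopologicalSpace M]
  [ChartedSpace (EuclideanSpace ℝ (Fin (d + 1))) M] [IsManifold (𝓡 (d + 1)) ∞ M]
  {g : LorentzianMetric d M} {m : ℝ} [hm : Fact (0 < m)]

instance finiteDimensional_shellTangentSpace (z : MassShell g m) :
    FiniteDimensional ℝ (TangentSpace (shellModel d) z) :=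
  inferInstanceAs (FiniteDimensional ℝ
    (EuclideanSpace ℝ (Fin (d + 1)) × EuclideanSpace ℝ (Fin d)))

theorem finrank_shellTangentSpace (z : MassShell g m) :
    Module.finrank ℝ (TangentSpace (shellModel d) z) = 2 * d + 1 := by
  change Module.finrank ℝ (EuclideanSpace ℝ (Fin (d + 1)) × EuclideanSpace ℝ (Fin d)) = _
  rw [Module.finrank_prod, finrank_euclideanSpace_fin, finrank_euclideanSpace_fin]
  ring

theorem MassShell.hamiltonian_neg (z : MassShell g m) :
    hamiltonian g z.incl < 0 := by
  have := hm.out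
  rw [z.hamiltonian_eq]
  have : 0 < m ^ 2 := by positivity
  linarith

theorem MassShell.mdifferentiableAt_incl (z : MassShell g m) :
    MDifferentiableAt (shellModel d) (𝓡 (d + 1)).tangent (MassShell.incl (g := g) (m := m)) z :=
  (MassShell.contMDiff_incl g m z).mdifferentiableAt (by simp)

/-- `H` is constant on the mass shell. -/
theorem dHamiltonian_mfderiv_incl (z : MassShell g m) (w : TangentSpace (shellModel d) z) :
    dHamiltonian g z.incl (mfderiv (shellModel d) (𝓡 (d + 1)).tangent MassShell.incl z w) = 0 := by
  have h := mvfderiv_comp_apply z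
    ((contMDiff_hamiltonian g).contMDiffAt.mdifferentiableAt (by simp)) z.mdifferentiableAt_incl w
  have h2 : hamiltonian g ∘ MassShell.incl (g := g) (m := m) = fun _ => -m ^ 2 / 2 :=
    funext fun z => z.hamiltonian_eq
  rw [h2, mvfderiv_const] at h
  exact h.symm

/-- A vector normal to the mass shell, normalized by `dH`. -/
theorem exists_dHamiltonian_eq_one (z : MassShell g m) : ∃ u, dHamiltonian g z.incl u = 1 := by
  -- The Euler field is transverse to the shell, as `dH(U) = 2H = -m²` there.
  refine ⟨(2 * hamiltonian g z.incl)⁻¹ • eulerField z.incl, ?_⟩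
  rw [map_smul, dHamiltonian_eulerField, smul_eq_mul, inv_mul_cancel₀]
  exact mul_ne_zero two_ne_zero z.hamiltonian_neg.ne

/-- The image of the differential of `ι` lies in the kernel of `dH`, and both have dimension `2d +
1`: the inclusion is an immersion and `dH ≠ 0`. As `dH(L) = 0`, `L` lies in this image, so the
choice defining the field on the shell is realized. -/
theorem mfderiv_incl_shellLiouvilleField (A : Potential d M) (q : ℝ) (z : MassShell g m) :
    mfderiv (shellModel d) (𝓡 (d + 1)).tangent MassShell.incl z (shellLiouvilleField g A q m z) =
      liouvilleField g A q z.incl := by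
  let ι' := (mfderiv (shellModel d) (𝓡 (d + 1)).tangent
    (MassShell.incl (g := g) (m := m)) z).toLinearMap
  let a := (dHamiltonian g z.incl).toLinearMap
  have h1 : LinearMap.range ι' = LinearMap.ker a := by
    refine Submodule.eq_of_le_of_finrank_eq ?_ ?_
    · rintro _ ⟨w, rfl⟩
      exact dHamiltonian_mfderiv_incl z w
    · rw [LinearMap.finrank_range_of_inj (MassShell.injective_mfderiv_incl g m z),
        finrank_shellTangentSpace]
      have h2 := LinearMap.finrank_range_add_finrank_ker a
      obtain ⟨u, hu⟩ := exists_dHamiltonian_eq_one z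
      have h3 : LinearMap.range a = ⊤ := by
        refine LinearMap.range_eq_top.2 fun r => ⟨r • u, ?_⟩
        have : a u = 1 := hu
        rw [map_smul, this, smul_eq_mul, mul_one]
      rw [h3, finrank_top, Module.finrank_self, finrank_tangentSpace] at h2
      omega
  have h4 : liouvilleField g A q z.incl ∈ LinearMap.range ι' := by
    rw [h1]
    exact dHamiltonian_liouvilleField g A q z.incl
  obtain ⟨w, hw⟩ := h4
  exact Classical.epsilon_spec (p := fun w =>
    mfderiv (shellModel d) (𝓡 (d + 1)).tangent MassShell.incl z w = liouvilleField g A q z.incl)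
    ⟨w, hw⟩

/-- The value of the induced volume form is `Λ(u, ·)` for any `u` with `dH(u) = 1`. -/
theorem IsShellVolumeForm.apply {A : Potential d M} {q : ℝ}
    {Ω : DiffForm (shellModel d) (MassShell g m) (2 * d + 1)} (hΩ : IsShellVolumeForm g A q m Ω)
    (z : MassShell g m) {u : TangentSpace (𝓡 (d + 1)).tangent z.incl}
    (hu : dHamiltonian g z.incl u = 1) (w : Fin (2 * d + 1) → TangentSpace (shellModel d) z) :
    Ω z w = tangentVolumeForm g A q z.incl (Fin.cons u fun i =>
      mfderiv (shellModel d) (𝓡 (d + 1)).tangent MassShell.incl z (w i)) := by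
  obtain ⟨σ, hσ, rfl⟩ := hΩ
  rw [← hσ.2 z.incl z.hamiltonian_neg, wedgeOne_cons_of_forall_eq_zero _ _ _ _
    fun i => dHamiltonian_mfderiv_incl z (w i), hu, one_mul]
  rfl

/-- The formula `Λ(u, ·)` for the value of the form does not involve `σ`, so any two candidates
agree. -/
theorem existsUnique_isShellVolumeForm (A : Potential d M) (q : ℝ) :
    ∃! Ω, IsShellVolumeForm g A q m Ω := by
  refine ⟨_, ⟨_, isTransverseFactor_transverseFactor g A q, rfl⟩, fun Ω hΩ => ?_⟩
  funext z
  ext w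
  obtain ⟨u, hu⟩ := exists_dHamiltonian_eq_one z
  rw [hΩ.apply z hu,
    IsShellVolumeForm.apply ⟨_, isTransverseFactor_transverseFactor g A q, rfl⟩ z hu]

theorem map_cons_cons_swap {V : Type*} [AddCommGroup V] [Module ℝ V] [TopologicalSpace V] {k : ℕ}
    (γ : V [⋀^Fin (k + 1 + 1)]→L[ℝ] ℝ) (x y : V) (w : Fin k → V) :
    γ (Fin.cons x (Fin.cons y w : Fin (k + 1) → V)) =
      - γ (Fin.cons y (Fin.cons x w : Fin (k + 1) → V)) := by
  have h := γ.toAlternatingMap.map_swap (Fin.cons y (Fin.cons x w : Fin (k + 1) → V))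
    (i := 0) (j := 1) (by simp)
  have h1 : (Fin.cons y (Fin.cons x w : Fin (k + 1) → V) : Fin (k + 1 + 1) → V) ∘
      Equiv.swap 0 1 = Fin.cons x (Fin.cons y w : Fin (k + 1) → V) := by
    funext i
    refine Fin.cases ?_ (fun i => Fin.cases ?_ (fun i => ?_) i) i
    · simp
    · simp
    · have : Equiv.swap (0 : Fin (k + 1 + 1)) 1 i.succ.succ = i.succ.succ :=
        Equiv.swap_apply_of_ne_of_ne (by simp) (by simp [Fin.ext_iff])
      simp [this]
  rw [h1] at h
  exact h

/-- `i_L Ω` is a multiple of the pull-back of `Ω_s ∧ ⋯ ∧ Ω_s` (`d` factors). -/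
theorem IsShellVolumeForm.interiorProduct_eq {A : Potential d M} {q : ℝ}
    {Ω : DiffForm (shellModel d) (MassShell g m) (2 * d + 1)} (hΩ : IsShellVolumeForm g A q m Ω)
    (z : MassShell g m) :
    interiorProduct (shellLiouvilleField g A q m z) (Ω z) =
      ((volumeConst d * (d + 1)) • wedgePow (n := d) rfl
        (symplecticForm g A q z.incl)).compContinuousLinearMap
        (mfderiv (shellModel d) (𝓡 (d + 1)).tangent MassShell.incl z) := by
  ext w
  obtain ⟨u, hu⟩ := exists_dHamiltonian_eq_one z
  rw [interiorProduct_apply, hΩ.apply z hu]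
  have h1 : (fun i => mfderiv (shellModel d) (𝓡 (d + 1)).tangent MassShell.incl z
      ((Fin.cons (shellLiouvilleField g A q m z) w :
        Fin (2 * d + 1) → TangentSpace (shellModel d) z) i)) =
      Fin.cons (liouvilleField g A q z.incl)
        fun i => mfderiv (shellModel d) (𝓡 (d + 1)).tangent MassShell.incl z (w i) := by
    funext i
    refine Fin.cases ?_ (fun i => ?_) i
    · exact mfderiv_incl_shellLiouvilleField A q z
    · rfl
  -- The value is `Λ(u, L, w) = -Λ(L, u, w)`. This sign cancels the one in `i_L Ω_s = -dH`; then
  -- `dH(u) = 1` and `dH(w_i) = 0` leave only the power of `Ω_s`.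
  rw [h1, map_cons_cons_swap, ← interiorProduct_apply]
  have h2 := interiorProduct_wedgePow (n := d) rfl (by ring) (symplecticForm g A q z.incl)
    (liouvilleField g A q z.incl) (- dHamiltonian g z.incl)
    (fun u => (symplecticForm_liouvilleField g A q z.incl u).symm)
  have h3 : interiorProduct (liouvilleField g A q z.incl) (tangentVolumeForm g A q z.incl) =
      volumeConst d • interiorProduct (liouvilleField g A q z.incl) (wedgePow (n := d + 1)
        (N := 2 * d + 1 + 1) (by ring) (symplecticForm g A q z.incl)) := rfl
  rw [h3, h2, ContinuousAlternatingMap.smul_apply, ContinuousAlternatingMap.smul_apply,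
    wedgeOne_cons_of_forall_eq_zero _ _ _ _ fun i => by
      rw [neg_apply, dHamiltonian_mfderiv_incl z (w i), neg_zero],
    neg_apply, hu, ContinuousAlternatingMap.compContinuousLinearMap_apply,
    ContinuousAlternatingMap.smul_apply]
  simp only [smul_eq_mul]
  change _ = _ * wedgePow (n := d) rfl (symplecticForm g A q z.incl) fun i =>
    mfderiv (shellModel d) (𝓡 (d + 1)).tangent MassShell.incl z (w i)
  ring

/-- A constant model form is what makes `i_L Ω` smooth and closed, and what reduces `d(fω)` to `df ∧
ω`. -/
theorem IsShellVolumeForm.eventually_eq_pullbackVec {A : Potential d M} {q : ℝ}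
    {Ω : DiffForm (shellModel d) (MassShell g m) (2 * d + 1)} (hΩ : IsShellVolumeForm g A q m Ω)
    (z₀ : MassShell g m) :
    ∀ᶠ z in 𝓝 z₀, interiorProduct (shellLiouvilleField g A q m z) (Ω z) =
      pullbackVec (shellModel d) (legendre g A q z₀.incl.proj ∘ MassShell.incl)
        (fun _ => (volumeConst d * (d + 1)) • wedgePow (n := d) rfl
          (canonicalTwoForm (EuclideanSpace ℝ (Fin (d + 1))))) z := by
  have h : Continuous fun z : MassShell g m => z.incl.proj :=
    (FiberBundle.continuous_proj _ _).comp (MassShell.isInducing_incl g m).continuous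
  filter_upwards [((chartAt (EuclideanSpace ℝ (Fin (d + 1)))
    z₀.incl.proj).open_source.preimage h).mem_nhds (mem_chart_source _ z₀.incl.proj)] with z hz
  rw [hΩ.interiorProduct_eq z, symplecticForm_eq_pullbackVec g A q hz,
    ← pullbackVec_comp_incl z.mdifferentiableAt_incl
      ((contMDiffAt_legendre g A q hz).mdifferentiableAt (by simp)), pullbackVec, ← wedgePow_comp]
  rfl

theorem contMDiffAt_legendre_incl (A : Potential d M) (q : ℝ) (z : MassShell g m) :
    ContMDiffAt (shellModel d) 𝓘(ℝ, EuclideanSpace ℝ (Fin (d + 1)) ×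
      (EuclideanSpace ℝ (Fin (d + 1)) →L[ℝ] ℝ)) ∞
      (legendre g A q z.incl.proj ∘ MassShell.incl) z :=
  (contMDiffAt_legendre g A q (mem_chart_source _ _)).comp z (MassShell.contMDiff_incl g m z)

end Shell
end RelKinetic

/-! ### The main theorem -/

theorem mainTheorem8 {d : ℕ} {M : Type*} [TopologicalSpace M]
    [ChartedSpace (EuclideanSpace ℝ (Fin (d + 1))) M] [IsManifold (𝓡 (d + 1)) ∞ M]
    (g : LorentzianMetric d M) (A : Potential d M) (q m : ℝ) [Fact (0 < m)] :
    (∃! Ω, IsShellVolumeForm g A q m Ω) ∧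
    ∀ Ω, IsShellVolumeForm g A q m Ω →
      let L := shellLiouvilleField g A q m
      let ωL : DiffForm (shellModel d) (MassShell g m) (2 * d) := fun z =>
        interiorProduct (L z) (Ω z)
      SmoothFormOn ωL Set.univ ∧
      mExtDeriv ωL = 0 ∧
      ∀ f : MassShell g m → ℝ, ContMDiff (shellModel d) 𝓘(ℝ, ℝ) ∞ f →
        mExtDeriv (fun z => f z • ωL z) = fun z => shellLieDeriv L f z • Ω z := by
  refine ⟨existsUnique_isShellVolumeForm A q, fun Ω hΩ => ?_⟩
  refine ⟨smoothFormOn_of_pullbackVec fun z _ => ⟨_, _, hΩ.eventually_eq_pullbackVec z,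
    contMDiffAt_legendre_incl A q z, contDiffAt_const⟩, ?_, fun f hf => ?_⟩
  · funext z
    rw [mExtDeriv_eq_pullbackVec (hΩ.eventually_eq_pullbackVec z)
      (contMDiffAt_legendre_incl A q z) (differentiableAt_const _), pullbackVec]
    ext v
    simp [extDeriv, ContinuousAlternatingMap.alternatizeUncurryFin_apply]
  · funext z
    rw [mExtDeriv_smul_const (hΩ.eventually_eq_pullbackVec z)
      (contMDiffAt_legendre_incl A q z) (hf z)]
    -- Contract `df ∧ Ω` with `L`; it is zero, having degree `2d + 2` on a manifold of dimension `2d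
    -- + 1`.
    have h := interiorProduct_wedgeOne (mvfderiv (shellModel d) f z) (Ω z)
      (shellLiouvilleField g A q m z)
    rw [eq_zero_of_finrank_lt (by rw [finrank_shellTangentSpace]; omega)
      (wedgeOne (mvfderiv (shellModel d) f z) (Ω z))] at h
    exact (sub_eq_zero.1 h.symm).symm
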